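/- A digraph $G=(V,E,w)$ has a finite vertex set $V$, directed edges $E\subseteq V\times V$ without self-loops, and positive real edge weights $w$. Let $d_G(u,v)$ be the minimum weight of a path from $u$ to $v$ ($\infty$ if there is none), and write $u\rightsquigarrow_G v$ if there is a path from $u$ to $v$ in $G$. The aspect ratio of $G$ is $$\Phi=\frac{\max\{d_G(u,v)\mid u\ne v,\ u\rightsquigarrow_G v\}}{\min\{d_G(u,v)\mid u\ne v,\ u\rightsquigarrow_G v\}}$$ (with $\Phi=0$ if $G$ has no edges). A stochastic embedding of $G$ into DAGs is a probability distribution $\mathcal D$ over pairs $(D_1,D_2)$ of weighted directed acyclic graphs on the vertex set $V$ such that every pair $(D_1,D_2)$ in its support satisfies: - (dominating distances) $d_G(u,v)\le\min\{d_{D_1}(u,v),d_{D_2}(u,v)\}$ for all $u,v\in V$; - (reachability preservation) for all $u\ne v$ in $V$ with $u\rightsquigarrow_G v$, exactly one of $u\rightsquigarrow_{D_1}v$ and $u\rightsquigarrow_{D_2}v$ holds. It has expected distortion at most $t$ if for all $u,v\in V$ $$\mathbb E_{(D_1,D_2)\sim\mathcal D}\Big[d_{D_1}(u,v)\cdot\mathbf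 1[u\rightsquigarrow_{D_1}v]+d_{D_2}(u,v)\cdot\mathbf 1[u\rightsquigarrow_{D_2}v]\Big]\le t\cdot d_G(u,v).$$ **Theorem (Bounded Aspect Ratio).** Every $n$-vertex digraph with $m$ edges and polynomial aspect ratio has a stochastic embedding into DAGs with expected distortion $O(\log n\cdot\log\log n)$ such that every DAG in the support has at most $O(n\log n+m\log^2 n)$ edges. Precisely: for every $k\in\mathbb N$ there is a constant $C>0$ such that every digraph $G$ with $n\ge 3$ vertices, $m$ edges and aspect ratio $\Phi\le n^k$ has a stochastic embedding $\mathcal D$ into DAGs with expected distortion at most $C\log_2 n\cdot\log_2\log_2 n$ such that, for every $(D_1,D_2)$ in the support of $\mathcal D$, both $D_1$ and $D_2$ have at most $C\,(n\log_2 n+m\log_2^2 n)$ edges. -/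

import Mathlib

open scoped ENNReal NNReal

/-- A weighted digraph on the vertex set `V`: a set of directed edges without self-loops, and a
positive real weight on every edge. -/
structure WeightedDigraph (V : Type*) extends Digraph V where
  loopless : ∀ v, ¬ Adj v v
  weight : ∀ {u v : V}, Adj u v → ℝ≥0
  weight_pos : ∀ {u v : V} (h : Adj u v), 0 < weight h

namespace WeightedDigraph

/-- Directed walks from `u` to `v`. -/
inductive Walk {V : Type*} (G : WeightedDigraph V) : V → V → Type _
  | nil {u : V} : Walk G u u
  | cons {u v w : V} (h : G.Adj u v) (p : Walk G v w) : Walk G u w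

/-- The number of edges of a walk. -/
def Walk.length {V : Type*} {G : WeightedDigraph V} : ∀ {u v : V}, G.Walk u v → ℕ
  | _, _, .nil => 0
  | _, _, .cons _ p => p.length + 1

/-- The total weight of a walk. -/
def Walk.totalWeight {V : Type*} {G : WeightedDigraph V} : ∀ {u v : V}, G.Walk u v → ℝ≥0
  | _, _, .nil => 0
  | _, _, .cons h p => G.weight h + p.totalWeight

/-- `v` is reachable from `u` in `G` (every vertex is reachable from itself). -/
def Reachable {V : Type*} (G : WeightedDigraph V) (u v : V) : Prop :=
  Nonempty (G.Walk u v)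

/-- The shortest path distance `d_G(u,v)`. It is `∞` if there is no walk from `u` to `v`. As the
weights are positive, it makes no difference whether walks may repeat vertices. -/
noncomputable def dist {V : Type*} (G : WeightedDigraph V) (u v : V) : ℝ≥0∞ :=
  ⨅ p : G.Walk u v, (p.totalWeight : ℝ≥0∞)

/-- The number of edges. -/
noncomputable def numEdges {V : Type*} (G : WeightedDigraph V) : ℕ :=
  {e : V × V | G.Adj e.1 e.2}.ncard

/-- `G` is a DAG: it has no directed cycle, i.e. no closed walk with at least one edge. -/
def IsDAG {V : Type*} (G : WeightedDigraph V) : Prop :=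
  ∀ (v : V) (p : G.Walk v v), p.length = 0

/-- The aspect ratio: the largest finite distance divided by the smallest finite distance, over
pairs of distinct vertices. (For a digraph without edges it is `0 / ∞ = 0`.) -/
noncomputable def aspectRatio {V : Type*} (G : WeightedDigraph V) : ℝ≥0∞ :=
  (⨆ (u : V) (v : V) (_ : u ≠ v ∧ G.Reachable u v), G.dist u v) /
    (⨅ (u : V) (v : V) (_ : u ≠ v ∧ G.Reachable u v), G.dist u v)

/-- The distribution `𝒟` over pairs of weighted digraphs on `V` is a stochastic embedding of `G`
into DAGs. -/
structure IsStochasticEmbedding {V : Type*} (G : WeightedDigraph V)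
    (𝒟 : PMF (WeightedDigraph V × WeightedDigraph V)) : Prop where
  /-- Both digraphs are DAGs. -/
  isDAG : ∀ D ∈ 𝒟.support, D.1.IsDAG ∧ D.2.IsDAG
  /-- Distances are dominating. -/
  dominating : ∀ D ∈ 𝒟.support, ∀ u v : V, G.dist u v ≤ min (D.1.dist u v) (D.2.dist u v)
  /-- Reachability of distinct vertices is preserved by exactly one of the two DAGs. -/
  reachability : ∀ D ∈ 𝒟.support, ∀ u v : V, u ≠ v → G.Reachable u v →
    Xor (D.1.Reachable u v) (D.2.Reachable u v)

open Classical in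
/-- The expectation over `(D₁, D₂) ∼ 𝒟` of
`d_{D₁}(u,v) * 1[v reachable from u in D₁] + d_{D₂}(u,v) * 1[v reachable from u in D₂]`. -/
noncomputable def expectedDist {V : Type*} (𝒟 : PMF (WeightedDigraph V × WeightedDigraph V))
    (u v : V) : ℝ≥0∞ :=
  ∑' D : WeightedDigraph V × WeightedDigraph V, 𝒟 D *
    ((if D.1.Reachable u v then D.1.dist u v else 0) +
      (if D.2.Reachable u v then D.2.dist u v else 0))

/-- The distribution `𝒟` has expected distortion (at most) `t` with respect to `G`. -/
def HasExpectedDistortion {V : Type*} (G : WeightedDigraph V)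
    (𝒟 : PMF (WeightedDigraph V × WeightedDigraph V)) (t : ℝ≥0∞) : Prop :=
  ∀ u v : V, expectedDist 𝒟 u v ≤ t * G.dist u v

end WeightedDigraph

/-! Everything comes from a random linear order of the vertices, paired with an ultrametric `δ ≥
d_G` whose balls are intervals of the order (`IsLaminar`). For every pair at finite distance, the
expectation of `δ x y` over the event that `y` precedes `x` is `O(log n · log log n) · d_G(x,y)`.

By minimax (`exists_stdSimplex_forall_le`) it is enough to find, for any nonnegative capacities on
pairs, one order whose capacity-weighted backward cost is small. It is built by recursive bisection:
a part of finite diameter is cut along a ball around one end of a diametral pair, and every cut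
backward pair pays the diameter. A double-logarithm version of region growing (`exists_radius`)
finds a radius whose boundary is cheap relative to `v log (M / v)`, and these costs telescope
against the potential `M log (M / σ)` (`exists_isLaminar_of_card`).

Given an order, the edges of the two DAGs go along it and against it, weighted by `d_G`. Acyclicity,
domination and the exclusive half of reachability are then automatic. The backward DAG is a two-hop
spanner on the ranks; since balls are intervals, it realizes distances up to `2δ`. The forward DAG
adds, for every edge of `G` and every pair of scales, a link from the last vertex of the tail's
cluster to the first vertex of the head's cluster. The aspect ratio leaves `O(log n)` scales, hence
`O(m log² n)` links. A walk of `G` with backward edges is imitated in the forward DAG by detours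
through cluster ends, and each detour is charged to a backward edge (`exists_cluster_of_walk`).
Taking expectations along the walk gives the distortion. -/

/-! ### Region growing with a double logarithm -/

section RegionGrowing

open Finset

variable {V : Type*}

/-- The contribution of the pair `(a, b)` to the volume of the ball `{z | p z ≤ r}`. -/
noncomputable def pairVol (c ℓ : V → V → ℝ) (p : V → ℝ) (r : ℝ) (a b : V) : ℝ :=
  if p a ≤ r then c a b * (if p b ≤ r then ℓ a b else r - p a) else 0

/-- The volume of the ball `{z ∈ C | p z ≤ r}`: every vertex contributes `σ`, the pairs contribute
the part of their volume that lies inside the ball. -/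
noncomputable def ballVol (C : Finset V) (c ℓ : V → V → ℝ) (σ : ℝ) (p : V → ℝ) (r : ℝ) : ℝ :=
  (∑ a ∈ C, if p a ≤ r then σ else 0) + ∑ a ∈ C, ∑ b ∈ C, pairVol c ℓ p r a b

/-- The capacity of the pairs that leave the ball `{z ∈ C | p z ≤ r}`. -/
noncomputable def ballCut (C : Finset V) (c : V → V → ℝ) (p : V → ℝ) (r : ℝ) : ℝ :=
  ∑ a ∈ C, ∑ b ∈ C, if p a ≤ r ∧ r < p b then c a b else 0

/-- The volume of a set of vertices. -/
noncomputable def setVol (c ℓ : V → V → ℝ) (σ : ℝ) (C : Finset V) : ℝ :=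
  (∑ _a ∈ C, σ) + ∑ a ∈ C, ∑ b ∈ C, c a b * ℓ a b

variable {C : Finset V} {c ℓ : V → V → ℝ} {σ : ℝ} {p : V → ℝ}

theorem ballVol_mono (hc : ∀ a b, 0 ≤ c a b) (hℓ : ∀ a b, 0 ≤ ℓ a b) (hσ : 0 ≤ σ)
    (hp : ∀ a ∈ C, ∀ b ∈ C, p b ≤ p a + ℓ a b) {r s : ℝ} (hrs : r ≤ s) :
    ballVol C c ℓ σ p r ≤ ballVol C c ℓ σ p s := by
  unfold ballVol
  refine add_le_add (sum_le_sum fun a _ => ?_)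
    (sum_le_sum fun a ha => sum_le_sum fun b hb => ?_)
  · split_ifs <;> linarith
  · unfold pairVol
    have := hp a ha b hb
    have := hℓ a b
    by_cases h1 : p a ≤ r
    · rw [if_pos h1, if_pos (h1.trans hrs)]
      refine mul_le_mul_of_nonneg_left ?_ (hc a b)
      split_ifs <;> linarith
    · rw [if_neg h1]
      split_ifs
      · exact mul_nonneg (hc a b) (hℓ a b)
      · exact mul_nonneg (hc a b) (by linarith)
      · exact le_rfl

/-- While no vertex enters the ball, each leaving pair grows linearly, so the slope of the volume is
the cut. -/
theorem ballVol_add_cut_le (hc : ∀ a b, 0 ≤ c a b) (hσ : 0 ≤ σ)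
    {r s : ℝ} (hrs : r ≤ s) (hgap : ∀ z ∈ C, p z ≤ r ∨ s < p z) :
    ballVol C c ℓ σ p r + ballCut C c p r * (s - r) ≤ ballVol C c ℓ σ p s := by
  unfold ballVol ballCut
  rw [add_assoc, sum_mul, ← sum_add_distrib]
  refine add_le_add (sum_le_sum fun a _ => ?_) (sum_le_sum fun a ha => ?_)
  · split_ifs <;> linarith
  · rw [sum_mul, ← sum_add_distrib]
    refine sum_le_sum fun b hb => ?_
    unfold pairVol
    have := hc a b
    rcases hgap a ha with h1 | h1
    · rcases hgap b hb with h2 | h2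
      · rw [if_pos h1, if_pos h2, if_neg (fun h => absurd h.2 (not_lt.2 h2)),
          if_pos (h1.trans hrs), if_pos (h2.trans hrs)]
        simp
      · rw [if_pos h1, if_neg (by linarith), if_pos ⟨h1, by linarith⟩,
          if_pos (h1.trans hrs), if_neg (by linarith)]
        nlinarith
    · rw [if_neg (by linarith), if_neg (fun h => absurd h.1 (by linarith)), if_neg (by linarith)]
      simp

theorem setVol_ball_le (hc : ∀ a b, 0 ≤ c a b) (r : ℝ) :
    setVol c ℓ σ (C.filter (p · ≤ r)) ≤ ballVol C c ℓ σ p r := by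
  unfold setVol ballVol
  rw [sum_filter, sum_filter]
  refine add_le_add le_rfl (sum_le_sum fun a _ => ?_)
  unfold pairVol
  split_ifs with h
  · rw [sum_filter]
    refine sum_le_sum fun b _ => ?_
    split_ifs
    · exact le_rfl
    · exact mul_nonneg (hc a b) (by linarith)
  · simp

/-- A leaving pair disappears from both parts, which makes room for the portion of it that the ball
counts. -/
theorem setVol_compl_le (hc : ∀ a b, 0 ≤ c a b) (hℓ : ∀ a b, 0 ≤ ℓ a b)
    (hp : ∀ a ∈ C, ∀ b ∈ C, p b ≤ p a + ℓ a b) (r : ℝ) :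
    setVol c ℓ σ (C.filter (¬ p · ≤ r)) + ballVol C c ℓ σ p r ≤ setVol c ℓ σ C := by
  unfold setVol ballVol
  rw [sum_filter, sum_filter, add_add_add_comm, ← sum_add_distrib, ← sum_add_distrib]
  refine add_le_add (sum_le_sum fun a _ => ?_) (sum_le_sum fun a ha => ?_)
  · by_cases h : p a ≤ r <;> simp [h]
  · unfold pairVol
    by_cases h : p a ≤ r
    · simp only [h, not_true, if_false, if_true, zero_add]
      refine sum_le_sum fun b hb => mul_le_mul_of_nonneg_left ?_ (hc a b)
      have := hp a ha b hb
      split_ifs <;> linarith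
    · simp only [h, not_false_eq_true, if_true, if_false, sum_const_zero, add_zero]
      exact sum_le_sum_of_subset_of_nonneg (filter_subset _ _)
        fun b _ _ => mul_nonneg (hc a b) (hℓ a b)

/-- Balls around the two ends of a pair at distance larger than the sum of the radii have disjoint
volumes. -/
theorem ballVol_add_ballVol_le {q : V → ℝ} (hc : ∀ a b, 0 ≤ c a b) (hℓ : ∀ a b, 0 ≤ ℓ a b)
    (hσ : 0 ≤ σ) (hp : ∀ a ∈ C, ∀ b ∈ C, p b ≤ p a + ℓ a b)
    (hq : ∀ a ∈ C, ∀ b ∈ C, q a ≤ q b + ℓ a b) {r s : ℝ}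
    (hpq : ∀ a ∈ C, r + s < p a + q a)
    (hpq' : ∀ a ∈ C, ∀ b ∈ C, r + s ≤ p a + ℓ a b + q b) :
    ballVol C c ℓ σ p r + ballVol C (fun a b => c b a) (fun a b => ℓ b a) σ q s ≤
      setVol c ℓ σ C := by
  unfold setVol ballVol
  rw [sum_comm (f := fun a b => pairVol (fun a b => c b a) (fun a b => ℓ b a) q s a b),
    add_add_add_comm, ← sum_add_distrib, ← sum_add_distrib]
  refine add_le_add (sum_le_sum fun a ha => ?_) (sum_le_sum fun a ha => ?_)
  · have := hpq a ha
    split_ifs <;> linarith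
  · rw [← sum_add_distrib]
    refine sum_le_sum fun b hb => ?_
    unfold pairVol
    have h1 := hpq a ha
    have h2 := hpq b hb
    have h3 := hpq' a ha b hb
    have h4 := mul_nonneg (hc a b) (hℓ a b)
    have h5 := hc a b
    by_cases ha1 : p a ≤ r
    · by_cases hb2 : q b ≤ s
      · rw [if_pos ha1, if_pos hb2, if_neg (by linarith), if_neg (by linarith), ← mul_add]
        exact mul_le_mul_of_nonneg_left (by linarith) h5
      · rw [if_pos ha1, if_neg hb2, add_zero]
        refine mul_le_mul_of_nonneg_left ?_ h5
        split_ifs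
        · exact le_rfl
        · linarith [hp a ha b hb]
    · rw [if_neg ha1, zero_add]
      split_ifs
      · exact le_rfl
      · exact mul_le_mul_of_nonneg_left (by linarith [hq a ha b hb]) h5
      · exact h4

/-- Continuous induction for a function that may jump: at the supremum of the radii with the desired
growth, monotonicity preserves the inequality, and `hstep` would push beyond it. -/
theorem add_mul_le_of_growth {g : ℝ → ℝ} {R κ B : ℝ} (hR : 0 < R) (hκ : 0 < κ)
    (hg : MonotoneOn g (Set.Ico 0 R))
    (hstep : ∀ r ∈ Set.Ico 0 R, ∃ s ∈ Set.Ioo r R, g r + κ * (s - r) ≤ g s)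
    (hB : ∀ r ∈ Set.Ico 0 R, g r ≤ B) : g 0 + κ * R ≤ B := by
  set S := {s | s ∈ Set.Ico 0 R ∧ g 0 + κ * s ≤ g s} with hS
  have h0 : (0 : ℝ) ∈ S := ⟨⟨le_rfl, hR⟩, by simp⟩
  have hbdd : BddAbove S := ⟨R, fun s hs => hs.1.2.le⟩
  have h0t : 0 ≤ sSup S := le_csSup hbdd h0
  have hsup : ∀ D, (∀ s ∈ S, g s ≤ D) → g 0 + κ * sSup S ≤ D := by
    intro D hD
    have : sSup S ≤ (D - g 0) / κ := by
      refine csSup_le ⟨0, h0⟩ fun s hs => ?_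
      rw [le_div_iff₀ hκ]
      linarith [hs.2, hD s hs]
    rw [le_div_iff₀ hκ] at this
    linarith
  rcases lt_or_ge (sSup S) R with ht | ht
  · have htS : sSup S ∈ Set.Ico 0 R := ⟨h0t, ht⟩
    have h1 := hsup (g (sSup S)) fun s hs => hg hs.1 htS (le_csSup hbdd hs)
    obtain ⟨s, hs, hgs⟩ := hstep _ htS
    have : s ≤ sSup S := le_csSup hbdd ⟨⟨h0t.trans hs.1.le, hs.2⟩, by linarith⟩
    exact absurd hs.1 (not_lt.2 this)
  · have := hsup B fun s hs => hB s hs.1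
    nlinarith

/-- One step of growth of the double logarithm. -/
theorem neg_log_log_add_le {M v h K : ℝ} (hv : 0 < v) (hh : 0 ≤ h) (hhv : h ≤ v)
    (hM : v + h < M) (hK : K * (v * Real.log (M / v)) ≤ h) :
    -Real.log (Real.log (M / v)) + K / 2 ≤ -Real.log (Real.log (M / (v + h))) := by
  have hM0 : 0 < M := by linarith
  have hy : 0 < Real.log (M / v) := Real.log_pos (by rw [lt_div_iff₀ hv]; linarith)
  have hy' : 0 < Real.log (M / (v + h)) :=
    Real.log_pos (by rw [lt_div_iff₀ (by linarith)]; linarith)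
  have e1 : Real.log (M / (v + h)) = Real.log (M / v) - Real.log ((v + h) / v) := by
    rw [Real.log_div hM0.ne' (by linarith), Real.log_div hM0.ne' hv.ne',
      Real.log_div (by linarith) hv.ne']
    ring
  -- `log (1 + h/v) ≥ h/(v+h)`, and `h ≤ v` bounds the denominator by `2v`; this loses the factor 2
  -- in `K / 2`.
  have e2 : h / (2 * v) ≤ Real.log ((v + h) / v) := by
    have := Real.one_sub_inv_le_log_of_pos (x := (v + h) / v) (by positivity)
    refine le_trans ?_ this
    rw [inv_div, one_sub_div (by linarith), div_le_div_iff₀ (by linarith) (by linarith)]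
    nlinarith
  have e3 : Real.log (Real.log (M / (v + h)) / Real.log (M / v)) ≤
      Real.log (M / (v + h)) / Real.log (M / v) - 1 :=
    Real.log_le_sub_one_of_pos (by positivity)
  rw [Real.log_div hy'.ne' hy.ne'] at e3
  have e4 : Real.log (M / (v + h)) / Real.log (M / v) - 1 ≤ -(K / 2) := by
    rw [e1, sub_div, div_self hy.ne']
    have : K / 2 ≤ Real.log ((v + h) / v) / Real.log (M / v) := by
      rw [le_div_iff₀ hy]
      refine le_trans ?_ e2
      rw [le_div_iff₀ (by linarith)]
      linarith
    linarith
  linarith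

/-- If every cut were too large, `-log log (M / v)` would grow at rate at least `K / (4R)`, gaining
`K / 4` in total. But it starts at least at `-log log N`, as `v ≥ σ`, and stays at most `-log log
2`, as `v ≤ M / 2`. The difference is `log (logb 2 N) < K / 4`. -/
theorem exists_radius (hc : ∀ a b, 0 ≤ c a b) (hℓ : ∀ a b, 0 ≤ ℓ a b) (hσ : 0 < σ)
    (hp : ∀ a ∈ C, ∀ b ∈ C, p b ≤ p a + ℓ a b) {x : V} (hx : x ∈ C) (hpx : p x = 0)
    {R M N K : ℝ} (hR : 0 < R) (hM : ∀ r ∈ Set.Ico 0 R, ballVol C c ℓ σ p r ≤ M / 2)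
    (hN : M ≤ N * σ) (hK : 4 * Real.log (Real.logb 2 N) < K) :
    ∃ r ∈ Set.Ico 0 R, ballCut C c p r * (2 * R) ≤
      K * (ballVol C c ℓ σ p r * Real.log (M / ballVol C c ℓ σ p r)) := by
  by_contra! hcon
  set v := ballVol C c ℓ σ p with hv
  have hmono : ∀ {r s}, r ≤ s → v r ≤ v s := fun h => ballVol_mono hc hℓ hσ.le hp h
  have hv0 : σ ≤ v 0 := by
    have h1 : σ ≤ ∑ a ∈ C, if p a ≤ 0 then σ else 0 := by
      refine le_trans ?_ (single_le_sum (f := fun a => if p a ≤ 0 then σ else 0) ?_ hx)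
      · simp [hpx]
      · intro i _
        split_ifs <;> linarith
    have h2 : 0 ≤ ∑ a ∈ C, ∑ b ∈ C, pairVol c ℓ p 0 a b := by
      refine sum_nonneg fun a _ => sum_nonneg fun b _ => ?_
      unfold pairVol
      split_ifs
      · exact mul_nonneg (hc a b) (hℓ a b)
      · exact mul_nonneg (hc a b) (by linarith)
      · exact le_rfl
    exact le_add_of_le_of_nonneg h1 h2
  have hvpos : ∀ r ∈ Set.Ico 0 R, 0 < v r := fun r hr => hσ.trans_le (hv0.trans (hmono hr.1))
  have hM0 : 0 < M := by linarith [hM 0 ⟨le_rfl, hR⟩]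
  have hl2 : 0 < Real.log 2 := Real.log_pos one_lt_two
  have hlog2 : ∀ r ∈ Set.Ico 0 R, Real.log 2 ≤ Real.log (M / v r) := fun r hr => by
    refine Real.log_le_log two_pos ?_
    rw [le_div_iff₀ (hvpos r hr)]
    linarith [hM r hr]
  have hN2 : 2 ≤ N := by
    have := hM 0 ⟨le_rfl, hR⟩
    by_contra! h
    nlinarith
  have hK0 : 0 < K := by
    refine lt_of_le_of_lt ?_ hK
    have : 0 ≤ Real.log (Real.logb 2 N) := by
      refine Real.log_nonneg ?_
      rw [Real.le_logb_iff_rpow_le one_lt_two (by linarith)]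
      simpa using hN2
    linarith
  have key := add_mul_le_of_growth (g := fun r => -Real.log (Real.log (M / v r)))
    (κ := K / (4 * R)) (B := -Real.log (Real.log 2)) hR (by positivity) ?_ ?_ ?_
  · have h1 : Real.log (Real.log (M / v 0)) ≤ Real.log (Real.log N) := by
      refine Real.log_le_log (hl2.trans_le (hlog2 0 ⟨le_rfl, hR⟩)) (Real.log_le_log ?_ ?_)
      · have := hvpos 0 ⟨le_rfl, hR⟩
        positivity
      · rw [div_le_iff₀ (hvpos 0 ⟨le_rfl, hR⟩)]
        nlinarith
    have h2 : K / (4 * R) * R = K / 4 := by field_simp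
    rw [Real.logb, Real.log_div (Real.log_pos (by linarith)).ne' hl2.ne'] at hK
    simp only [h2] at key
    linarith
  · intro r hr s hs hrs
    have h1 := hl2.trans_le (hlog2 s hs)
    refine neg_le_neg (Real.log_le_log h1 (Real.log_le_log ?_ ?_))
    · have := hvpos s hs
      positivity
    · exact div_le_div_of_nonneg_left hM0.le (hvpos r hr) (hmono hrs)
  · intro r hr
    have hcut := hcon r hr
    set γ := ballCut C c p r with hγ
    have hy := hl2.trans_le (hlog2 r hr)
    have hvr := hvpos r hr
    have hγ0 : 0 < γ := by
      have : 0 < K * (v r * Real.log (M / v r)) := by positivity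
      by_contra! h
      nlinarith
    obtain ⟨t, hrt, ht⟩ : ∃ t, r < t ∧ ∀ z ∈ C, p z ≤ r ∨ t < p z := by
      have : ∀ᶠ t in nhdsWithin r (Set.Ioi r), ∀ z ∈ C, p z ≤ r ∨ t < p z := by
        rw [Filter.eventually_all_finset]
        intro z _
        rcases le_or_gt (p z) r with h | h
        · exact Filter.Eventually.of_forall fun _ => Or.inl h
        · filter_upwards [Ioo_mem_nhdsGT h] with t ht using Or.inr ht.2
      obtain ⟨t, h1, h2⟩ := (this.and self_mem_nhdsWithin).exists
      exact ⟨t, h2, h1⟩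
    -- The step stops before the next vertex enters, stays below `R`, and at most doubles the linear
    -- estimate of the volume, as `neg_log_log_add_le` requires.
    set s := min t (min ((r + R) / 2) (r + v r / γ)) with hs
    have hrs : r < s := by
      refine lt_min hrt (lt_min ?_ ?_)
      · linarith [hr.2]
      · have : 0 < v r / γ := by positivity
        linarith
    have hsR : s < R := by
      refine lt_of_le_of_lt ((min_le_right _ _).trans (min_le_left _ _)) ?_
      linarith [hr.2]
    have hst : s ≤ r + v r / γ := (min_le_right _ _).trans (min_le_right _ _)
    have hsv : v r + γ * (s - r) ≤ v s := ballVol_add_cut_le hc hσ.le hrs.le fun z hz =>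
      (ht z hz).imp_right fun h => lt_of_le_of_lt (min_le_left _ _) h
    have hsmem : s ∈ Set.Ico 0 R := ⟨hr.1.trans hrs.le, hsR⟩
    refine ⟨s, ⟨hrs, hsR⟩, ?_⟩
    have hle : γ * (s - r) ≤ v r := by
      have : s - r ≤ v r / γ := by linarith
      rw [le_div_iff₀ hγ0] at this
      linarith
    have hvs := hvpos s hsmem
    have h0 : 0 ≤ γ * (s - r) := mul_nonneg hγ0.le (by linarith)
    have h1 := neg_log_log_add_le (M := M) (v := v r) (h := γ * (s - r))
      (K := K / (2 * R) * (s - r)) hvr h0 hle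
      (by linarith [hM s hsmem]) (by
        have e : K / (2 * R) * (s - r) * (v r * Real.log (M / v r)) =
          (K * (v r * Real.log (M / v r))) / (2 * R) * (s - r) := by ring
        rw [e]
        refine mul_le_mul_of_nonneg_right ?_ (by linarith)
        rw [div_le_iff₀ (by linarith)]
        exact hcut.le)
    have h2 : Real.log (Real.log (M / v s)) ≤ Real.log (Real.log (M / (v r + γ * (s - r)))) := by
      refine Real.log_le_log (hl2.trans_le (hlog2 s hsmem)) (Real.log_le_log (by positivity) ?_)
      exact div_le_div_of_nonneg_left hM0.le (by linarith) hsv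
    have e : K / (4 * R) * (s - r) = K / (2 * R) * (s - r) / 2 := by
      field_simp
      ring
    rw [e]
    linarith
  · intro r hr
    exact neg_le_neg (Real.log_le_log hl2 (hlog2 r hr))

end RegionGrowing

/-! ### Splitting a set in two at low cost -/

section Splitting

open Finset

theorem mul_log_mono {σ s t : ℝ} (hσ : 0 < σ) (hs : σ ≤ s) (hst : s ≤ t) :
    s * Real.log (s / σ) ≤ t * Real.log (t / σ) := by
  have h1 : 1 ≤ s / σ := by rwa [le_div_iff₀ hσ, one_mul]
  exact mul_le_mul hst (Real.log_le_log (by linarith)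
    (div_le_div_of_nonneg_right hst hσ.le)) (Real.log_nonneg h1) (by linarith)

/-- Splitting `M` into `v` and `M - v` lowers the potential `s log (s / σ)` by `v log (M / v) + (M -
v) log (M / (M - v))`; the second term is nonnegative and dropped. -/
theorem mul_log_div_le {σ a b v M : ℝ} (hσ : 0 < σ) (ha : σ ≤ a) (hav : a ≤ v) (hb : σ ≤ b)
    (hbv : b + v ≤ M) :
    v * Real.log (M / v) ≤
      M * Real.log (M / σ) - a * Real.log (a / σ) - b * Real.log (b / σ) := by
  have h1 := mul_log_mono hσ ha hav
  have h2 := mul_log_mono hσ hb (t := M - v) (by linarith)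
  have hv : 0 < v := by linarith
  have hMv : 0 < M - v := by linarith
  have hM : 0 < M := by linarith
  have h3 : Real.log (M - v) ≤ Real.log M := Real.log_le_log hMv (by linarith)
  rw [Real.log_div hv.ne' hσ.ne'] at h1
  rw [Real.log_div hMv.ne' hσ.ne'] at h2
  rw [Real.log_div hM.ne' hv.ne', Real.log_div hM.ne' hσ.ne']
  nlinarith

variable {V : Type*}

/-- The diameter of a set of vertices in an asymmetric metric. -/
noncomputable def weakDiam (d : V → V → ℝ≥0∞) (C : Finset V) : ℝ≥0∞ :=
  (C ×ˢ C).sup fun q => d q.1 q.2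

theorem le_weakDiam {d : V → V → ℝ≥0∞} {C : Finset V} {x y : V} (hx : x ∈ C) (hy : y ∈ C) :
    d x y ≤ weakDiam d C :=
  le_sup (f := fun q : V × V => d q.1 q.2) (mk_mem_product hx hy)

theorem weakDiam_mono {d : V → V → ℝ≥0∞} {A C : Finset V} (h : A ⊆ C) :
    weakDiam d A ≤ weakDiam d C :=
  sup_mono (product_subset_product h h)

theorem exists_weakDiam_eq {d : V → V → ℝ≥0∞} {C : Finset V} (h : C.Nonempty) :
    ∃ x ∈ C, ∃ y ∈ C, weakDiam d C = d x y := by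
  obtain ⟨q, hq, he⟩ := exists_mem_eq_sup (C ×ˢ C) (h.product h) fun q : V × V => d q.1 q.2
  exact ⟨q.1, (mem_product.1 hq).1, q.2, (mem_product.1 hq).2, he⟩

theorem le_setVol {c ℓ : V → V → ℝ} {σ : ℝ} {C : Finset V} (hc : ∀ a b, 0 ≤ c a b)
    (hℓ : ∀ a b, 0 ≤ ℓ a b) (hσ : 0 ≤ σ) (hC : C.Nonempty) : σ ≤ setVol c ℓ σ C := by
  obtain ⟨x, hx⟩ := hC
  exact le_add_of_le_of_nonneg (single_le_sum (f := fun _ : V => σ) (fun _ _ => hσ) hx)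
    (sum_nonneg fun a _ => sum_nonneg fun b _ => mul_nonneg (hc a b) (hℓ a b))

theorem setVol_swap (c ℓ : V → V → ℝ) (σ : ℝ) (C : Finset V) :
    setVol (fun a b => c b a) (fun a b => ℓ b a) σ C = setVol c ℓ σ C := by
  unfold setVol
  rw [sum_comm]

theorem ballCut_eq (C : Finset V) (c : V → V → ℝ) (p : V → ℝ) (r : ℝ) :
    ballCut C c p r = ∑ a ∈ C.filter (p · ≤ r), ∑ b ∈ C.filter (¬ p · ≤ r), c a b := by
  unfold ballCut
  rw [sum_filter]
  refine sum_congr rfl fun a _ => ?_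
  split_ifs with h
  · rw [sum_filter]
    exact sum_congr rfl fun b _ => by simp [h]
  · simp [h]

/-- Region growing: a set of finite diameter splits into two parts such that the capacity of the
pairs going from the second part to the first one is small. -/
theorem exists_split_of_finite [DecidableEq V] {d : V → V → ℝ≥0∞} (hd0 : ∀ x, d x x = 0)
    (hdpos : ∀ x y, x ≠ y → 0 < d x y) (htri : ∀ x y z, d x z ≤ d x y + d y z)
    {c : V → V → ℝ} (hc : ∀ a b, 0 ≤ c a b) {σ N K : ℝ} (hσ : 0 < σ)
    (hK : 4 * Real.log (Real.logb 2 N) < K) (hK0 : 0 ≤ K) {C : Finset V} (hC : 1 < #C)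
    (hfin : weakDiam d C ≠ ⊤) {ℓ : V → V → ℝ} (hℓ : ℓ = fun a b => (d a b).toReal)
    {f : Finset V → ℝ} (hf : f = fun S => setVol c ℓ σ S * Real.log (setVol c ℓ σ S / σ))
    (hN : setVol c ℓ σ C ≤ N * σ) :
    ∃ A B, Disjoint A B ∧ A ∪ B = C ∧ A.Nonempty ∧ B.Nonempty ∧
      (∑ b ∈ B, ∑ a ∈ A, c b a) * (weakDiam d C).toReal ≤ K * (f C - f A - f B) := by
  have hne : C.Nonempty := card_pos.1 (by omega)
  have hdfin : ∀ x ∈ C, ∀ y ∈ C, d x y ≠ ⊤ := fun x hx y hy =>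
    ne_top_of_le_ne_top hfin (le_weakDiam hx hy)
  have htri' : ∀ x ∈ C, ∀ y ∈ C, ∀ z ∈ C, ℓ x z ≤ ℓ x y + ℓ y z := by
    intro x hx y hy z hz
    simp only [hℓ]
    rw [← ENNReal.toReal_add (hdfin x hx y hy) (hdfin y hy z hz)]
    exact ENNReal.toReal_mono (ENNReal.add_ne_top.2 ⟨hdfin x hx y hy, hdfin y hy z hz⟩)
      (htri x y z)
  have hℓ0 : ∀ a b, 0 ≤ ℓ a b := fun a b => by simp [hℓ]
  have hℓs : ∀ a, ℓ a a = 0 := fun a => by simp [hℓ, hd0]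
  obtain ⟨x, hx, y, hy, hxy⟩ := exists_weakDiam_eq (d := d) hne
  have hΔ : (weakDiam d C).toReal = ℓ x y := by rw [hxy, hℓ]
  have hΔ0 : 0 < ℓ x y := by
    obtain ⟨a, ha, b, hb, hab⟩ := one_lt_card.1 hC
    have h1 : 0 < weakDiam d C := (hdpos a b hab).trans_le (le_weakDiam ha hb)
    rw [← hΔ]
    exact ENNReal.toReal_pos h1.ne' hfin
  set M := setVol c ℓ σ C with hMdef
  set R := ℓ x y / 2 with hR
  have hR0 : 0 < R := by linarith
  have hp : ∀ a ∈ C, ∀ b ∈ C, ℓ x b ≤ ℓ x a + ℓ a b := fun a ha b hb => htri' x hx a ha b hb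
  have hq : ∀ a ∈ C, ∀ b ∈ C, ℓ a y ≤ ℓ b y + ℓ a b := fun a ha b hb => by
    linarith [htri' a ha b hb y hy]
  -- Radii below half the diameter keep the out-ball of `x` and the in-ball of `y` disjoint in
  -- volume, so one of the two families never exceeds `M / 2`.
  have hcase : (∀ r ∈ Set.Ico 0 R, ballVol C c ℓ σ (fun z => ℓ x z) r ≤ M / 2) ∨
      (∀ r ∈ Set.Ico 0 R,
        ballVol C (fun a b => c b a) (fun a b => ℓ b a) σ (fun z => ℓ z y) r ≤ M / 2) := by
    by_contra! h
    obtain ⟨⟨r, hr, h1⟩, ⟨s, hs, h2⟩⟩ := h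
    have := ballVol_add_ballVol_le (C := C) (p := fun z => ℓ x z) (q := fun z => ℓ z y) (r := r)
      (s := s) hc hℓ0 hσ.le hp hq
      (fun a ha => by linarith [htri' x hx a ha y hy, hr.2, hs.2])
      (fun a ha b hb => by
        linarith [htri' x hx a ha y hy, htri' a ha b hb y hy, hr.2, hs.2])
    linarith
  have hfl : ∀ S, f S = setVol c ℓ σ S * Real.log (setVol c ℓ σ S / σ) := fun S => by rw [hf]
  rcases hcase with hcase | hcase
  -- The out-ball becomes the later part `B`, so the pairs leaving it are exactly the backward ones.
  · obtain ⟨r, hr, hcut⟩ := exists_radius hc hℓ0 hσ hp hx (hℓs x) hR0 hcase hN hK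
    have hA : (C.filter (¬ ℓ x · ≤ r)).Nonempty :=
      ⟨y, mem_filter.2 ⟨hy, by linarith [hr.2]⟩⟩
    have hB : (C.filter (ℓ x · ≤ r)).Nonempty :=
      ⟨x, mem_filter.2 ⟨hx, by rw [hℓs]; exact hr.1⟩⟩
    refine ⟨C.filter (¬ ℓ x · ≤ r), C.filter (ℓ x · ≤ r),
      (disjoint_filter_filter_not C C _).symm, ?_, hA, hB, ?_⟩
    · rw [union_comm, filter_union_filter_not_eq]
    · rw [ballCut_eq] at hcut
      rw [hΔ]
      have e : ℓ x y = 2 * R := by rw [hR]; ring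
      rw [e]
      refine hcut.trans (mul_le_mul_of_nonneg_left ?_ hK0)
      have := mul_log_div_le hσ (le_setVol hc hℓ0 hσ.le hB) (setVol_ball_le hc r)
        (le_setVol hc hℓ0 hσ.le hA) (setVol_compl_le (σ := σ) hc hℓ0 hp r)
      rw [hfl, hfl, hfl]
      linarith
  -- Same argument with all pairs reversed: the in-ball becomes the earlier part `A`, and the pairs
  -- entering it are backward.
  · obtain ⟨r, hr, hcut⟩ := exists_radius (fun a b => hc b a) (fun a b => hℓ0 b a) hσ
      (fun a ha b hb => hq b hb a ha) hy (hℓs y) hR0 hcase hN hK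
    have hB : (C.filter (¬ ℓ · y ≤ r)).Nonempty :=
      ⟨x, mem_filter.2 ⟨hx, by linarith [hr.2]⟩⟩
    have hA : (C.filter (ℓ · y ≤ r)).Nonempty :=
      ⟨y, mem_filter.2 ⟨hy, by rw [hℓs]; exact hr.1⟩⟩
    refine ⟨C.filter (ℓ · y ≤ r), C.filter (¬ ℓ · y ≤ r),
      disjoint_filter_filter_not C C _, filter_union_filter_not_eq _ _, hA, hB, ?_⟩
    rw [ballCut_eq] at hcut
    rw [hΔ, sum_comm]
    have e : ℓ x y = 2 * R := by rw [hR]; ring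
    rw [e]
    refine hcut.trans (mul_le_mul_of_nonneg_left ?_ hK0)
    have h1 := setVol_ball_le (C := C) (ℓ := fun a b => ℓ b a) (σ := σ) (p := fun z => ℓ z y)
      (fun a b => hc b a) r
    have h2 := setVol_compl_le (C := C) (σ := σ) (p := fun z => ℓ z y) (fun a b => hc b a)
      (fun a b => hℓ0 b a) (fun a ha b hb => hq b hb a ha) r
    rw [setVol_swap c ℓ] at h1
    rw [setVol_swap c ℓ, setVol_swap c ℓ] at h2
    have := mul_log_div_le hσ (le_setVol hc hℓ0 hσ.le hA) h1 (le_setVol hc hℓ0 hσ.le hB) h2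
    rw [hfl, hfl, hfl]
    linarith

/-- A set of infinite diameter splits into two parts such that no pair from the second part to the
first one has finite distance. -/
theorem exists_split_of_infinite [DecidableEq V] {d : V → V → ℝ≥0∞} (hd0 : ∀ x, d x x = 0)
    (htri : ∀ x y z, d x z ≤ d x y + d y z) {C : Finset V} (hne : C.Nonempty)
    (hinf : weakDiam d C = ⊤) :
    ∃ A B, Disjoint A B ∧ A ∪ B = C ∧ A.Nonempty ∧ B.Nonempty ∧
      ∀ b ∈ B, ∀ a ∈ A, d b a = ⊤ := by
  classical
  obtain ⟨x, hx, y, hy, hxy⟩ := exists_weakDiam_eq (d := d) hne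
  refine ⟨C.filter (¬ d x · ≠ ⊤), C.filter (d x · ≠ ⊤),
    (disjoint_filter_filter_not C C _).symm, ?_, ⟨y, ?_⟩, ⟨x, ?_⟩, ?_⟩
  · rw [union_comm, filter_union_filter_not_eq]
  · exact mem_filter.2 ⟨hy, by rw [← hxy, hinf]; simp⟩
  · exact mem_filter.2 ⟨hx, by simp [hd0]⟩
  · intro b hb a ha
    have h1 := (mem_filter.1 hb).2
    have h2 := not_not.1 (mem_filter.1 ha).2
    have := htri x b a
    rw [h2, top_le_iff, ENNReal.add_eq_top] at this
    exact this.resolve_left h1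

end Splitting

/-! ### Laminar orders from recursive splitting -/

section Laminar

open Finset

variable {V : Type*}

/-- An ordering `r` of the vertices in `C`, together with an ultrametric `δ` that dominates `d`
and is compatible with the ordering: the `δ`-balls are intervals of the ordering. -/
structure IsLaminar (d : V → V → ℝ≥0∞) (C : Finset V) (r : V → ℕ) (δ : V → V → ℝ≥0∞) : Prop where
  rank_lt : ∀ x ∈ C, r x < #C
  rank_inj : ∀ x ∈ C, ∀ y ∈ C, r x = r y → x = y
  symm : ∀ x ∈ C, ∀ y ∈ C, δ x y = δ y x
  le : ∀ x ∈ C, ∀ y ∈ C, d x y ≤ δ x y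
  self : ∀ x ∈ C, δ x x = 0
  ultra : ∀ x ∈ C, ∀ y ∈ C, ∀ z ∈ C, δ x z ≤ max (δ x y) (δ y z)
  convex : ∀ x ∈ C, ∀ y ∈ C, ∀ z ∈ C, r x ≤ r y → r y ≤ r z → δ x y ≤ δ x z
  convex' : ∀ x ∈ C, ∀ y ∈ C, ∀ z ∈ C, r x ≤ r y → r y ≤ r z → δ y z ≤ δ x z
  ne_top : ∀ x ∈ C, ∀ y ∈ C, r y < r x → d x y ≠ ⊤ → δ x y ≠ ⊤
  exists_eq : ∀ x ∈ C, ∀ y ∈ C, ∃ a b, δ x y = d a b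
  le_diam : ∀ x ∈ C, ∀ y ∈ C, δ x y ≤ weakDiam d C

/-- The ordering that places `A` before the remaining vertices. -/
noncomputable def mergeRank [DecidableEq V] (A : Finset V) (r s : V → ℕ) (x : V) : ℕ :=
  if x ∈ A then r x else #A + s x

/-- The ultrametric in which `A` is at distance `D` from the remaining vertices. -/
noncomputable def mergeUltra [DecidableEq V] (A : Finset V) (D : ℝ≥0∞) (δ ε : V → V → ℝ≥0∞)
    (x y : V) : ℝ≥0∞ :=
  if x ∈ A then (if y ∈ A then δ x y else D) else (if y ∈ A then D else ε x y)

/-- Distances across the split become the diameter of the union, which dominates everything inside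
`A` and `B`; this gives the ultrametric and interval properties. `hfin` allows an infinite diameter
only when no backward pair across the split has finite distance. -/
theorem IsLaminar.merge [DecidableEq V] {d : V → V → ℝ≥0∞} {A B C : Finset V} {r s : V → ℕ}
    {δ ε : V → V → ℝ≥0∞} (hA : IsLaminar d A r δ) (hB : IsLaminar d B s ε)
    (hdisj : Disjoint A B) (hC : A ∪ B = C) (hne : C.Nonempty)
    (hfin : ∀ x ∈ B, ∀ y ∈ A, d x y ≠ ⊤ → weakDiam d C ≠ ⊤) :
    IsLaminar d C (mergeRank A r s) (mergeUltra A (weakDiam d C) δ ε) := by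
  have hAC : A ⊆ C := hC ▸ subset_union_left
  have hBC : B ⊆ C := hC ▸ subset_union_right
  have mem : ∀ x ∈ C, (x ∈ A ∧ x ∉ B) ∨ (x ∈ B ∧ x ∉ A) := by
    intro x hx
    rw [← hC, mem_union] at hx
    rcases hx with h | h
    · exact Or.inl ⟨h, disjoint_left.1 hdisj h⟩
    · exact Or.inr ⟨h, disjoint_right.1 hdisj h⟩
  have hcard : #C = #A + #B := by rw [← hC, card_union_of_disjoint hdisj]
  have hδ : ∀ x ∈ A, ∀ y ∈ A, δ x y ≤ weakDiam d C := fun x hx y hy =>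
    (hA.le_diam x hx y hy).trans (weakDiam_mono hAC)
  have hε : ∀ x ∈ B, ∀ y ∈ B, ε x y ≤ weakDiam d C := fun x hx y hy =>
    (hB.le_diam x hx y hy).trans (weakDiam_mono hBC)
  obtain ⟨p, _, q, _, hpq⟩ := exists_weakDiam_eq (d := d) hne
  constructor
  · intro x hx
    unfold mergeRank
    rcases mem x hx with ⟨h, _⟩ | ⟨h, h'⟩
    · rw [if_pos h]
      have := hA.rank_lt x h
      omega
    · rw [if_neg h']
      have := hB.rank_lt x h
      omega
  · intro x hx y hy h
    unfold mergeRank at h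
    rcases mem x hx with ⟨hx, _⟩ | ⟨hx, hx'⟩ <;> rcases mem y hy with ⟨hy, _⟩ | ⟨hy, hy'⟩
    · rw [if_pos hx, if_pos hy] at h
      exact hA.rank_inj x hx y hy h
    · rw [if_pos hx, if_neg hy'] at h
      have := hA.rank_lt x hx
      omega
    · rw [if_neg hx', if_pos hy] at h
      have := hA.rank_lt y hy
      omega
    · rw [if_neg hx', if_neg hy'] at h
      exact hB.rank_inj x hx y hy (by omega)
  · intro x hx y hy
    unfold mergeUltra
    rcases mem x hx with ⟨hx, _⟩ | ⟨hx, hx'⟩ <;> rcases mem y hy with ⟨hy, _⟩ | ⟨hy, hy'⟩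
    · simpa [hx, hy] using hA.symm x hx y hy
    · simp [hx, hy']
    · simp [hx', hy]
    · simpa [hx', hy'] using hB.symm x hx y hy
  · intro x hx y hy
    have hd := le_weakDiam (d := d) hx hy
    unfold mergeUltra
    rcases mem x hx with ⟨hx, _⟩ | ⟨hx, hx'⟩ <;> rcases mem y hy with ⟨hy, _⟩ | ⟨hy, hy'⟩
    · simpa [hx, hy] using hA.le x hx y hy
    · simpa [hx, hy'] using hd
    · simpa [hx', hy] using hd
    · simpa [hx', hy'] using hB.le x hx y hy
  · intro x hx
    unfold mergeUltra
    rcases mem x hx with ⟨hx, _⟩ | ⟨hx, hx'⟩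
    · simpa [hx] using hA.self x hx
    · simpa [hx'] using hB.self x hx
  · intro x hx y hy z hz
    unfold mergeUltra
    rcases mem x hx with ⟨hx, _⟩ | ⟨hx, hx'⟩ <;> rcases mem y hy with ⟨hy, _⟩ | ⟨hy, hy'⟩ <;>
      rcases mem z hz with ⟨hz, _⟩ | ⟨hz, hz'⟩
    · simpa [hx, hy, hz] using hA.ultra x hx y hy z hz
    · simp [*]
    · simpa [*] using hδ x hx z hz
    · simp [*]
    · simp [*]
    · simpa [*] using hε x hx z hz
    · simp [*]
    · simpa [hx', hy', hz'] using hB.ultra x hx y hy z hz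
  · intro x hx y hy z hz h1 h2
    unfold mergeRank at h1 h2
    unfold mergeUltra
    rcases mem x hx with ⟨hx, _⟩ | ⟨hx, hx'⟩ <;> rcases mem y hy with ⟨hy, _⟩ | ⟨hy, hy'⟩ <;>
      rcases mem z hz with ⟨hz, _⟩ | ⟨hz, hz'⟩
    · simp only [hx, hy, hz, if_true] at h1 h2 ⊢
      exact hA.convex x hx y hy z hz h1 h2
    · simpa [*] using hδ x hx y hy
    · simp only [hy', hz, if_true, if_false] at h2
      have := hA.rank_lt z hz
      omega
    · simp [*]
    · simp only [hx', hy, if_true, if_false] at h1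
      have := hA.rank_lt y hy
      omega
    · simp only [hx', hy, if_true, if_false] at h1
      have := hA.rank_lt y hy
      omega
    · simp only [hy', hz, if_true, if_false] at h2
      have := hA.rank_lt z hz
      omega
    · simp only [hx', hy', hz', if_false] at h1 h2 ⊢
      exact hB.convex x hx y hy z hz (by omega) (by omega)
  · intro x hx y hy z hz h1 h2
    unfold mergeRank at h1 h2
    unfold mergeUltra
    rcases mem x hx with ⟨hx, _⟩ | ⟨hx, hx'⟩ <;> rcases mem y hy with ⟨hy, _⟩ | ⟨hy, hy'⟩ <;>
      rcases mem z hz with ⟨hz, _⟩ | ⟨hz, hz'⟩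
    · simp only [hx, hy, hz, if_true] at h1 h2 ⊢
      exact hA.convex' x hx y hy z hz h1 h2
    · simp [*]
    · simp only [hy', hz, if_true, if_false] at h2
      have := hA.rank_lt z hz
      omega
    · simpa [*] using hε y hy z hz
    · simp only [hx', hy, if_true, if_false] at h1
      have := hA.rank_lt y hy
      omega
    · simp only [hx', hy, if_true, if_false] at h1
      have := hA.rank_lt y hy
      omega
    · simp only [hy', hz, if_true, if_false] at h2
      have := hA.rank_lt z hz
      omega
    · simp only [hx', hy', hz', if_false] at h1 h2 ⊢
      exact hB.convex' x hx y hy z hz (by omega) (by omega)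
  · intro x hx y hy h hd
    unfold mergeRank at h
    unfold mergeUltra
    rcases mem x hx with ⟨hx, _⟩ | ⟨hx, hx'⟩ <;> rcases mem y hy with ⟨hy, _⟩ | ⟨hy, hy'⟩
    · simp only [hx, hy, if_true] at h ⊢
      exact hA.ne_top x hx y hy h hd
    · simp only [hx, hy', if_true, if_false] at h
      have := hA.rank_lt x hx
      omega
    · simp only [hx', hy, if_true, if_false]
      exact hfin x hx y hy hd
    · simp only [hx', hy', if_false] at h ⊢
      exact hB.ne_top x hx y hy (by omega) hd
  · intro x hx y hy
    unfold mergeUltra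
    rcases mem x hx with ⟨hx, _⟩ | ⟨hx, hx'⟩ <;> rcases mem y hy with ⟨hy, _⟩ | ⟨hy, hy'⟩
    · simpa [hx, hy] using hA.exists_eq x hx y hy
    · exact ⟨p, q, by simpa [hx, hy'] using hpq⟩
    · exact ⟨p, q, by simpa [hx', hy] using hpq⟩
    · simpa [hx', hy'] using hB.exists_eq x hx y hy
  · intro x hx y hy
    unfold mergeUltra
    rcases mem x hx with ⟨hx, _⟩ | ⟨hx, hx'⟩ <;> rcases mem y hy with ⟨hy, _⟩ | ⟨hy, hy'⟩
    · simpa [hx, hy] using hδ x hx y hy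
    · simp [hx, hy']
    · simp [hx', hy]
    · simpa [hx', hy'] using hε x hx y hy

theorem isLaminar_singleton {d : V → V → ℝ≥0∞} (hd0 : ∀ x, d x x = 0) (x : V) :
    IsLaminar d {x} (fun _ => 0) (fun _ _ => 0) := by
  constructor <;> simp [hd0]
  exact ⟨x, x, (hd0 x).symm⟩

open Classical in
/-- The cost of the ordered pair `(x, y)`: if it goes backwards in the ordering, then it is charged
its ultrametric distance. -/
noncomputable def backCost (d : V → V → ℝ≥0∞) (r : V → ℕ) (δ : V → V → ℝ≥0∞) (x y : V) : ℝ :=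
  if r y < r x ∧ d x y ≠ ⊤ then (δ x y).toReal else 0

theorem sum_backCost_merge [DecidableEq V] {d : V → V → ℝ≥0∞} {A B C : Finset V} {r s : V → ℕ}
    {δ ε : V → V → ℝ≥0∞} (hA : IsLaminar d A r δ)
    (hdisj : Disjoint A B) (hC : A ∪ B = C) (D : ℝ≥0∞) {c : V → V → ℝ} (hc : ∀ a b, 0 ≤ c a b) :
    ∑ x ∈ C, ∑ y ∈ C, c x y * backCost d (mergeRank A r s) (mergeUltra A D δ ε) x y ≤
      (∑ x ∈ A, ∑ y ∈ A, c x y * backCost d r δ x y) +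
      (∑ x ∈ B, ∑ y ∈ B, c x y * backCost d s ε x y) +
      ∑ x ∈ B, ∑ y ∈ A, c x y * (if d x y ≠ ⊤ then D.toReal else 0) := by
  have hBA : ∀ x ∈ B, x ∉ A := fun x hx => disjoint_right.1 hdisj hx
  rw [← hC, sum_union hdisj, add_assoc]
  simp only [sum_union hdisj]
  rw [sum_add_distrib, sum_add_distrib]
  have e1 : ∀ x ∈ A, ∀ y ∈ A, backCost d (mergeRank A r s) (mergeUltra A D δ ε) x y =
      backCost d r δ x y := fun x hx y hy => by
    simp only [backCost, mergeRank, mergeUltra, hx, hy, if_true]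
  have e2 : ∀ x ∈ B, ∀ y ∈ B, backCost d (mergeRank A r s) (mergeUltra A D δ ε) x y =
      backCost d s ε x y := fun x hx y hy => by
    simp only [backCost, mergeRank, mergeUltra, hBA x hx, hBA y hy, if_false,
      Nat.add_lt_add_iff_left]
  have e3 : ∀ x ∈ A, ∀ y ∈ B, backCost d (mergeRank A r s) (mergeUltra A D δ ε) x y = 0 := by
    intro x hx y hy
    have := hA.rank_lt x hx
    simp only [backCost, mergeRank, mergeUltra, hx, hBA y hy, if_false, if_true]
    rw [if_neg]
    rintro ⟨h, _⟩
    omega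
  have e4 : ∀ x ∈ B, ∀ y ∈ A, c x y * backCost d (mergeRank A r s) (mergeUltra A D δ ε) x y ≤
      c x y * (if d x y ≠ ⊤ then D.toReal else 0) := by
    intro x hx y hy
    refine mul_le_mul_of_nonneg_left ?_ (hc x y)
    simp only [backCost, mergeRank, mergeUltra, hy, hBA x hx, if_false, if_true]
    split_ifs <;> simp_all
  have s1 : ∑ x ∈ A, ∑ y ∈ A,
      c x y * backCost d (mergeRank A r s) (mergeUltra A D δ ε) x y =
      ∑ x ∈ A, ∑ y ∈ A, c x y * backCost d r δ x y :=
    sum_congr rfl fun x hx => sum_congr rfl fun y hy => by rw [e1 x hx y hy]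
  have s2 : ∑ x ∈ B, ∑ y ∈ B,
      c x y * backCost d (mergeRank A r s) (mergeUltra A D δ ε) x y =
      ∑ x ∈ B, ∑ y ∈ B, c x y * backCost d s ε x y :=
    sum_congr rfl fun x hx => sum_congr rfl fun y hy => by rw [e2 x hx y hy]
  have s3 : ∑ x ∈ A, ∑ y ∈ B,
      c x y * backCost d (mergeRank A r s) (mergeUltra A D δ ε) x y = 0 :=
    sum_eq_zero fun x hx => sum_eq_zero fun y hy => by rw [e3 x hx y hy, mul_zero]
  have s4 := sum_le_sum fun x hx => sum_le_sum fun y hy => e4 x hx y hy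
  rw [s1, s2, s3]
  linarith

/-- Recursive splitting: the cost of each split is at most `K` times the drop of the potential, so
the sum telescopes. Splits at infinite diameter cost nothing. -/
theorem exists_isLaminar_of_card [DecidableEq V] {d : V → V → ℝ≥0∞} (hd0 : ∀ x, d x x = 0)
    (hdpos : ∀ x y, x ≠ y → 0 < d x y) (htri : ∀ x y z, d x z ≤ d x y + d y z)
    {c : V → V → ℝ} (hc : ∀ a b, 0 ≤ c a b) {σ N K : ℝ} (hσ : 0 < σ)
    (hK : 4 * Real.log (Real.logb 2 N) < K) (hK0 : 0 ≤ K)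
    {ℓ : V → V → ℝ} (hℓ : ℓ = fun a b => (d a b).toReal) :
    ∀ (k : ℕ) (C : Finset V), #C = k → C.Nonempty → setVol c ℓ σ C ≤ N * σ →
      ∃ r δ, IsLaminar d C r δ ∧ ∑ x ∈ C, ∑ y ∈ C, c x y * backCost d r δ x y ≤
        K * (setVol c ℓ σ C * Real.log (setVol c ℓ σ C / σ)) := by
  have hℓ0 : ∀ a b, 0 ≤ ℓ a b := fun a b => by simp [hℓ]
  have hf0 : ∀ S : Finset V, S.Nonempty →
      0 ≤ setVol c ℓ σ S * Real.log (setVol c ℓ σ S / σ) := by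
    intro S hS
    have := le_setVol hc hℓ0 hσ.le hS
    refine mul_nonneg (by linarith) (Real.log_nonneg ?_)
    rwa [le_div_iff₀ hσ, one_mul]
  have hmono : ∀ S T : Finset V, S ⊆ T → setVol c ℓ σ S ≤ setVol c ℓ σ T := by
    intro S T hST
    unfold setVol
    refine add_le_add (sum_le_sum_of_subset_of_nonneg hST fun _ _ _ => hσ.le) ?_
    refine (sum_le_sum fun a _ => sum_le_sum_of_subset_of_nonneg hST
      fun b _ _ => mul_nonneg (hc a b) (hℓ0 a b)).trans ?_
    exact sum_le_sum_of_subset_of_nonneg hST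
      fun a _ _ => sum_nonneg fun b _ => mul_nonneg (hc a b) (hℓ0 a b)
  intro k
  induction k using Nat.strong_induction_on with
  | _ k ih =>
  intro C hk hne hN
  by_cases h1 : 1 < #C
  · have main : ∃ A B, Disjoint A B ∧ A ∪ B = C ∧ A.Nonempty ∧ B.Nonempty ∧
        (∀ x ∈ B, ∀ y ∈ A, d x y ≠ ⊤ → weakDiam d C ≠ ⊤) ∧
        (∑ x ∈ B, ∑ y ∈ A, c x y * (if d x y ≠ ⊤ then (weakDiam d C).toReal else 0)) ≤
          K * (setVol c ℓ σ C * Real.log (setVol c ℓ σ C / σ) -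
            setVol c ℓ σ A * Real.log (setVol c ℓ σ A / σ) -
            setVol c ℓ σ B * Real.log (setVol c ℓ σ B / σ)) := by
      by_cases hfin : weakDiam d C = ⊤
      · obtain ⟨A, B, hd, hu, hA, hB, h⟩ := exists_split_of_infinite hd0 htri hne hfin
        refine ⟨A, B, hd, hu, hA, hB, fun x hx y hy h' => absurd (h x hx y hy) h', ?_⟩
        have hAB : setVol c ℓ σ A + setVol c ℓ σ B ≤ setVol c ℓ σ C := by
          have i1 : ∀ x ∈ A, ∑ y ∈ A, c x y * ℓ x y ≤ ∑ y ∈ C, c x y * ℓ x y := fun x _ =>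
            sum_le_sum_of_subset_of_nonneg (hu ▸ subset_union_left)
              fun b _ _ => mul_nonneg (hc x b) (hℓ0 x b)
          have i2 : ∀ x ∈ B, ∑ y ∈ B, c x y * ℓ x y ≤ ∑ y ∈ C, c x y * ℓ x y := fun x _ =>
            sum_le_sum_of_subset_of_nonneg (hu ▸ subset_union_right)
              fun b _ _ => mul_nonneg (hc x b) (hℓ0 x b)
          have j1 := sum_le_sum i1
          have j2 := sum_le_sum i2
          have j3 := sum_union (f := fun x => ∑ y ∈ C, c x y * ℓ x y) hd
          have j4 := sum_union (f := fun _ => σ) hd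
          rw [hu] at j3 j4
          unfold setVol
          linarith
        have lA := le_setVol hc hℓ0 hσ.le hA
        have lB := le_setVol hc hℓ0 hσ.le hB
        -- With `v` equal to the volume of `A`, this yields superadditivity of the potential.
        have := mul_log_div_le hσ lA le_rfl lB (M := setVol c ℓ σ C) (by linarith)
        have h0 : 0 ≤ setVol c ℓ σ A * Real.log (setVol c ℓ σ C / setVol c ℓ σ A) := by
          refine mul_nonneg (by linarith) (Real.log_nonneg ?_)
          rw [le_div_iff₀ (by linarith)]
          linarith
        rw [sum_eq_zero]
        · exact mul_nonneg hK0 (by linarith)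
        · exact fun x hx => sum_eq_zero fun y hy => by simp [h x hx y hy]
      · obtain ⟨A, B, hd, hu, hA, hB, h⟩ :=
          exists_split_of_finite hd0 hdpos htri hc hσ hK hK0 h1 hfin hℓ rfl hN
        refine ⟨A, B, hd, hu, hA, hB, fun x hx y hy _ => hfin, ?_⟩
        refine le_trans ?_ h
        simp only [sum_mul]
        refine sum_le_sum fun x _ => sum_le_sum fun y _ => mul_le_mul_of_nonneg_left ?_ (hc x y)
        split_ifs
        · exact le_rfl
        · exact ENNReal.toReal_nonneg
    obtain ⟨A, B, hd, hu, hA, hB, hfin, hcost⟩ := main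
    have hcard : #C = #A + #B := by rw [← hu, card_union_of_disjoint hd]
    have hA' := card_pos.2 hA
    have hB' := card_pos.2 hB
    obtain ⟨r, δ, hr, hrc⟩ := ih #A (by omega) A rfl hA
      ((hmono A C (hu ▸ subset_union_left)).trans hN)
    obtain ⟨s, ε, hs, hsc⟩ := ih #B (by omega) B rfl hB
      ((hmono B C (hu ▸ subset_union_right)).trans hN)
    refine ⟨_, _, hr.merge hs hd hu hne hfin, ?_⟩
    refine (sum_backCost_merge hr hd hu _ hc).trans ?_
    linarith
  · obtain ⟨x, rfl⟩ := card_eq_one.1 (le_antisymm (not_lt.1 h1) (card_pos.2 hne))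
    refine ⟨_, _, isLaminar_singleton hd0 x, ?_⟩
    simpa [backCost] using mul_nonneg hK0 (hf0 {x} (singleton_nonempty x))

/-- For all capacities `c` there is an ordering with an ultrametric that is good on average. -/
theorem exists_isLaminar_sum_le [Fintype V] [Nonempty V] {d : V → V → ℝ≥0∞}
    (hd0 : ∀ x, d x x = 0)
    (hdpos : ∀ x y, x ≠ y → 0 < d x y) (htri : ∀ x y z, d x z ≤ d x y + d y z)
    {c : V → V → ℝ} (hc : ∀ a b, 0 ≤ c a b) {K : ℝ}
    (hK : 4 * Real.log (Real.logb 2 (2 * Fintype.card V)) < K) (hK0 : 0 ≤ K) :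
    ∃ r δ, IsLaminar d univ r δ ∧ ∑ x, ∑ y, c x y * backCost d r δ x y ≤
      ∑ x, ∑ y, c x y * (2 * K * Real.log (2 * Fintype.card V) * (d x y).toReal) := by
  classical
  set n : ℝ := (Fintype.card V : ℝ) with hn
  have hn1 : 1 ≤ n := Nat.one_le_cast.2 Fintype.card_pos
  set ℓ : V → V → ℝ := fun a b => (d a b).toReal with hℓ
  have hℓ0 : ∀ a b, 0 ≤ ℓ a b := fun a b => by simp [hℓ]
  set W := ∑ x, ∑ y, c x y * ℓ x y with hW
  have hterm : ∀ x y, 0 ≤ c x y * ℓ x y := fun x y => mul_nonneg (hc x y) (hℓ0 x y)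
  have hW0 : 0 ≤ W := sum_nonneg fun x _ => sum_nonneg fun y _ => hterm x y
  have hvol : ∀ σ, setVol c ℓ σ univ = n * σ + W := fun σ => by
    simp [setVol, hn, hW]
  rcases hW0.eq_or_lt with h0 | hpos
  -- With zero total volume any `σ` will do: each term of the cost vanishes separately.
  · obtain ⟨r, δ, hr, -⟩ := exists_isLaminar_of_card hd0 hdpos htri hc (σ := 1) one_pos hK hK0
      hℓ _ univ rfl univ_nonempty (by rw [hvol]; linarith)
    refine ⟨r, δ, hr, le_of_eq ?_⟩
    have hz : ∀ x y, c x y * ℓ x y = 0 := by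
      intro x y
      have h1 := (sum_eq_zero_iff_of_nonneg fun x _ => sum_nonneg fun y _ => hterm x y).1 h0.symm x
        (mem_univ x)
      exact (sum_eq_zero_iff_of_nonneg fun y _ => hterm x y).1 h1 y (mem_univ y)
    refine sum_congr rfl fun x _ => sum_congr rfl fun y _ => ?_
    rcases mul_eq_zero.1 (hz x y) with h | h
    · rw [h, zero_mul, zero_mul]
    · have h' : (d x y).toReal = 0 := h
      rw [h', mul_zero, mul_zero, mul_eq_zero]
      right
      unfold backCost
      split_ifs with hb
      · rcases (ENNReal.toReal_eq_zero_iff _).1 h' with h2 | h2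
        · have hxy : x ≠ y := fun e => by simp [e] at hb
          exact absurd h2 (hdpos x y hxy).ne'
        · exact absurd h2 hb.2
      · rfl
  -- This `σ` gives the vertices the same total volume as the pairs, so the whole volume is `2W =
  -- 2nσ`: the ratio `N` is `2n` and the potential is `2W log (2n)`.
  · have hσ : 0 < W / n := by positivity
    have e : n * (W / n) = W := by field_simp
    have e2 : 2 * n * (W / n) = 2 * W := by rw [mul_assoc, e]
    obtain ⟨r, δ, hr, hcost⟩ := exists_isLaminar_of_card hd0 hdpos htri hc (σ := W / n) hσ hK hK0
      hℓ _ univ rfl univ_nonempty (by rw [hvol, e, e2]; linarith)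
    refine ⟨r, δ, hr, hcost.trans (le_of_eq ?_)⟩
    have e3 : (W + W) / (W / n) = 2 * n := by
      field_simp
      ring
    rw [hvol, e, e3]
    have : ∑ x, ∑ y, c x y * (2 * K * Real.log (2 * n) * (d x y).toReal) =
        2 * K * Real.log (2 * n) * W := by
      rw [hW, mul_sum]
      refine sum_congr rfl fun x _ => ?_
      rw [mul_sum]
      refine sum_congr rfl fun y _ => ?_
      simp only [hℓ]
      ring
    rw [this]
    ring

end Laminar

/-! ### From averages to a distribution by minimax -/

section Minimax

open Finset

/-- A form of the minimax theorem for finite games. -/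
theorem exists_stdSimplex_forall_le {O ι : Type*} [Fintype O] [Fintype ι] [Nonempty O]
    (X : O → ι → ℝ) (T : ι → ℝ)
    (H : ∀ c : ι → ℝ, (∀ i, 0 ≤ c i) → ∃ o, ∑ i, c i * X o i ≤ ∑ i, c i * T i) :
    ∃ w ∈ stdSimplex ℝ O, ∀ i, ∑ o, w o * X o i ≤ T i := by
  classical
  let Φ : (O → ℝ) →ₗ[ℝ] (ι → ℝ) := ∑ o, (LinearMap.proj o).smulRight (X o)
  have hΦ : ∀ w i, Φ w i = ∑ o, w o * X o i := by
    intro w i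
    simp [Φ, LinearMap.sum_apply, Finset.sum_apply]
  have hΦs : ∀ o, Φ (Pi.single o 1) = X o := by
    intro o
    ext i
    rw [hΦ, sum_eq_single o] <;> simp +contextual
  by_contra! hcon
  have hdisj : Disjoint (Φ '' stdSimplex ℝ O) {z | ∀ i, z i ≤ T i} := by
    rw [Set.disjoint_left]
    rintro _ ⟨w, hw, rfl⟩ hz
    obtain ⟨i, hi⟩ := hcon w hw
    exact absurd (hz i) (by rw [hΦ]; linarith)
  have hcl : IsClosed {z : ι → ℝ | ∀ i, z i ≤ T i} := by
    rw [Set.ofPred_forall]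
    exact isClosed_iInter fun i => isClosed_le (continuous_apply i) continuous_const
  have hconv : Convex ℝ {z : ι → ℝ | ∀ i, z i ≤ T i} := convex_Iic T
  -- Separate the compact convex set of attainable mean cost vectors from the orthant below `T`.
  obtain ⟨f, u, v, hu, huv, hv⟩ := geometric_hahn_banach_compact_closed
    ((convex_stdSimplex ℝ O).linear_image Φ)
    ((isCompact_stdSimplex ℝ O).image Φ.continuous_of_finiteDimensional) hconv hcl hdisj
  have hf : ∀ z, f z = ∑ i, z i * f (Pi.single i 1) := by
    intro z
    have := LinearMap.pi_apply_eq_sum_univ (f : (ι → ℝ) →ₗ[ℝ] ℝ) z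
    have e : ∀ i, (Pi.single i (1 : ℝ) : ι → ℝ) = fun j => if i = j then 1 else 0 := by
      intro i
      ext j
      rw [Pi.single_apply]
      exact if_congr eq_comm rfl rfl
    simp only [e]
    exact this
  -- The orthant is unbounded downwards while `f` stays above `v` on it. Hence `-f` is a vector of
  -- capacities, to which `H` applies.
  have hneg : ∀ i, f (Pi.single i 1) ≤ 0 := by
    intro i
    by_contra! h
    have h1 := hv T fun _ => le_rfl
    have h2 := hv (T - ((f T - v) / f (Pi.single i 1)) • Pi.single i 1) fun j => by
      have : 0 ≤ (f T - v) / f (Pi.single i 1) := div_nonneg (by linarith) h.le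
      have h3 : 0 ≤ (Pi.single i (1 : ℝ) : ι → ℝ) j := by
        rw [Pi.single_apply]
        split_ifs <;> norm_num
      have := mul_nonneg this h3
      simp only [Pi.sub_apply, Pi.smul_apply, smul_eq_mul]
      linarith
    rw [map_sub, map_smul, smul_eq_mul, div_mul_cancel₀ _ h.ne'] at h2
    linarith
  obtain ⟨o, ho⟩ := H (fun i => -f (Pi.single i 1)) fun i => by linarith [hneg i]
  have h1 := hu (X o) ⟨Pi.single o 1, single_mem_stdSimplex ℝ o, hΦs o⟩
  have h2 := hv T fun _ => le_rfl
  have e : ∀ z : ι → ℝ, ∑ i, -f (Pi.single i 1) * z i = -f z := by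
    intro z
    rw [hf z, ← sum_neg_distrib]
    exact sum_congr rfl fun i _ => by ring
  rw [e, e] at ho
  linarith

variable {V : Type*}

/-- The laminar orderings of all vertices. -/
abbrev LaminarOrder [Fintype V] (d : V → V → ℝ≥0∞) :=
  {o : (V → ℕ) × (V → V → ℝ≥0∞) // IsLaminar d univ o.1 o.2}

/-- Ranks are bounded, and the ultrametric only takes values of `d`; this is one purpose of
`exists_eq`. -/
theorem finite_laminarOrder [Fintype V] (d : V → V → ℝ≥0∞) : Finite (LaminarOrder d) := by
  have h1 : (Set.univ.pi fun _ : V => Set.Iio (Fintype.card V)).Finite :=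
    Set.Finite.pi fun _ => Set.finite_Iio _
  have h2 : (Set.univ.pi fun _ : V => Set.univ.pi fun _ : V =>
      Set.range fun q : V × V => d q.1 q.2).Finite :=
    Set.Finite.pi fun _ => Set.Finite.pi fun _ => Set.finite_range _
  refine ((h1.prod h2).subset ?_ :
    {o : (V → ℕ) × (V → V → ℝ≥0∞) | IsLaminar d univ o.1 o.2}.Finite).to_subtype
  rintro ⟨r, δ⟩ h
  refine ⟨fun x _ => h.rank_lt x (mem_univ x), fun x _ y _ => ?_⟩
  obtain ⟨a, b, hab⟩ := h.exists_eq x (mem_univ x) y (mem_univ y)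
  exact ⟨(a, b), hab.symm⟩

/-- There is a distribution over orderings with an ultrametric such that the expected cost of every
pair is small. -/
theorem exists_pmf_laminarOrder [Fintype V] [Nonempty V] {d : V → V → ℝ≥0∞}
    (hd0 : ∀ x, d x x = 0)
    (hdpos : ∀ x y, x ≠ y → 0 < d x y) (htri : ∀ x y z, d x z ≤ d x y + d y z) {K : ℝ}
    (hK : 4 * Real.log (Real.logb 2 (2 * Fintype.card V)) < K) (hK0 : 0 ≤ K) :
    ∃ P : PMF (LaminarOrder d), ∀ x y, d x y ≠ ⊤ →
      ∑' o, P o * (if o.1.1 y < o.1.1 x then o.1.2 x y else 0) ≤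
        ENNReal.ofReal (2 * K * Real.log (2 * Fintype.card V)) * d x y := by
  have := finite_laminarOrder d
  have := Fintype.ofFinite (LaminarOrder d)
  set K' := 2 * K * Real.log (2 * Fintype.card V) with hK'
  have hex : ∀ c : V × V → ℝ, (∀ i, 0 ≤ c i) → ∃ o : LaminarOrder d,
      ∑ i, c i * backCost d o.1.1 o.1.2 i.1 i.2 ≤ ∑ i, c i * (K' * (d i.1 i.2).toReal) := by
    intro c hc
    obtain ⟨r, δ, h, hle⟩ := exists_isLaminar_sum_le hd0 hdpos htri
      (c := fun a b => c (a, b)) (fun a b => hc (a, b)) hK hK0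
    refine ⟨⟨(r, δ), h⟩, ?_⟩
    rw [Fintype.sum_prod_type, Fintype.sum_prod_type]
    exact hle
  have : Nonempty (LaminarOrder d) := ⟨(hex 0 fun _ => le_rfl).choose⟩
  obtain ⟨w, hw, hle⟩ := exists_stdSimplex_forall_le
    (fun (o : LaminarOrder d) (i : V × V) => backCost d o.1.1 o.1.2 i.1 i.2)
    (fun i => K' * (d i.1 i.2).toReal) hex
  have hsum : ∑ o, ENNReal.ofReal (w o) = 1 := by
    rw [← ENNReal.ofReal_sum_of_nonneg fun o _ => hw.1 o, hw.2, ENNReal.ofReal_one]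
  refine ⟨PMF.ofFintype (fun o => ENNReal.ofReal (w o)) hsum, fun x y hxy => ?_⟩
  rw [tsum_fintype]
  have hterm : ∀ o : LaminarOrder d,
      PMF.ofFintype (fun o => ENNReal.ofReal (w o)) hsum o *
        (if o.1.1 y < o.1.1 x then o.1.2 x y else 0) =
      ENNReal.ofReal (w o * backCost d o.1.1 o.1.2 x y) := by
    intro o
    rw [PMF.ofFintype_apply, ENNReal.ofReal_mul (hw.1 o)]
    congr 1
    unfold backCost
    by_cases h : o.1.1 y < o.1.1 x
    · rw [if_pos h, if_pos ⟨h, hxy⟩,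
        ENNReal.ofReal_toReal (o.2.ne_top x (mem_univ x) y (mem_univ y) h hxy)]
    · rw [if_neg h, if_neg fun h' => h h'.1, ENNReal.ofReal_zero]
  have hb0 : ∀ o : LaminarOrder d, 0 ≤ backCost d o.1.1 o.1.2 x y := by
    intro o
    unfold backCost
    split_ifs
    · exact ENNReal.toReal_nonneg
    · exact le_rfl
  rw [sum_congr rfl fun o _ => hterm o,
    ← ENNReal.ofReal_sum_of_nonneg fun o _ => mul_nonneg (hw.1 o) (hb0 o)]
  have hlog : 0 ≤ K' := by
    have : (1 : ℝ) ≤ Fintype.card V := by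
      exact_mod_cast (Fintype.card_pos : 0 < Fintype.card V)
    have := Real.log_nonneg (x := 2 * (Fintype.card V : ℝ)) (by linarith)
    positivity
  rw [← ENNReal.ofReal_toReal hxy, ← ENNReal.ofReal_mul hlog]
  exact ENNReal.ofReal_le_ofReal (hle (x, y))

end Minimax

/-! ### Distances in digraphs, and digraphs weighted by distances -/

namespace WeightedDigraph

variable {V : Type*} {G : WeightedDigraph V}

/-- Concatenation of walks. -/
def Walk.append : ∀ {u v w : V}, G.Walk u v → G.Walk v w → G.Walk u w
  | _, _, _, .nil, q => q
  | _, _, _, .cons h p, q => .cons h (p.append q)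

theorem Walk.totalWeight_append : ∀ {u v w : V} (p : G.Walk u v) (q : G.Walk v w),
    (p.append q).totalWeight = p.totalWeight + q.totalWeight
  | _, _, _, .nil, q => by simp [Walk.append, Walk.totalWeight]
  | _, _, _, .cons h p, q => by
    simp [Walk.append, Walk.totalWeight, Walk.totalWeight_append p q, add_assoc]

theorem dist_le_totalWeight {u v : V} (p : G.Walk u v) : G.dist u v ≤ p.totalWeight :=
  iInf_le _ p

theorem dist_self (u : V) : G.dist u u = 0 :=
  le_antisymm ((dist_le_totalWeight .nil).trans (by simp [Walk.totalWeight])) bot_le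

theorem dist_triangle (u v w : V) : G.dist u w ≤ G.dist u v + G.dist v w := by
  unfold dist
  rw [ENNReal.iInf_add]
  refine le_iInf fun p => ?_
  rw [ENNReal.add_iInf]
  refine le_iInf fun q => ?_
  refine (iInf_le _ (p.append q)).trans ?_
  rw [Walk.totalWeight_append]
  simp

theorem dist_le_weight {u v : V} (h : G.Adj u v) : G.dist u v ≤ G.weight h :=
  (dist_le_totalWeight (.cons h .nil)).trans (by simp [Walk.totalWeight])

theorem dist_ne_top_iff {u v : V} : G.dist u v ≠ ⊤ ↔ G.Reachable u v := by
  constructor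
  · intro h
    by_contra hn
    have : IsEmpty (G.Walk u v) := not_nonempty_iff.1 hn
    exact h (iInf_of_empty _)
  · rintro ⟨p⟩
    exact ne_top_of_le_ne_top ENNReal.coe_ne_top (dist_le_totalWeight p)

/-- Finiteness supplies a positive least edge weight; without it the infimum over walks could be
zero. -/
theorem dist_pos [Finite V] {u v : V} (huv : u ≠ v) : 0 < G.dist u v := by
  classical
  let g : V × V → ℝ≥0∞ := fun e => if h : G.Adj e.1 e.2 then G.weight h else ⊤
  have : Nonempty (V × V) := ⟨(u, v)⟩
  obtain ⟨e, he⟩ := Finite.exists_min g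
  have hpos : 0 < g e := by
    unfold g
    split_ifs with h
    · exact_mod_cast G.weight_pos h
    · exact ENNReal.zero_lt_top
  refine hpos.trans_le (le_iInf fun p => ?_)
  cases p with
  | nil => exact absurd rfl huv
  | @cons _ w _ h p =>
    refine (he (u, w)).trans ?_
    simp only [g, h, dif_pos, Walk.totalWeight]
    exact_mod_cast le_self_add

/-- The digraph with the edges prescribed by a relation, weighted by the distances in `G`. -/
noncomputable def ofRel (G : WeightedDigraph V) (F : V → V → Prop) : WeightedDigraph V where
  Adj u v := F u v ∧ 0 < G.dist u v ∧ G.dist u v ≠ ⊤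
  loopless v h := by
    rw [dist_self] at h
    exact lt_irrefl _ h.2.1
  weight {u v} _ := (G.dist u v).toNNReal
  weight_pos h := ENNReal.toNNReal_pos h.2.1.ne' h.2.2

variable {F : V → V → Prop}

/-- Every edge weighs the distance in `G`, so domination is the triangle inequality, whichever edges
are chosen. -/
theorem dist_le_dist_ofRel (u v : V) : G.dist u v ≤ (G.ofRel F).dist u v := by
  refine le_iInf fun p => ?_
  induction p with
  | nil => simp [dist_self]
  | @cons u v w h p ih =>
    refine (dist_triangle u v w).trans ?_
    simp only [Walk.totalWeight, ENNReal.coe_add]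
    refine add_le_add ?_ ih
    exact (ENNReal.coe_toNNReal h.2.2).ge

theorem dist_ofRel_le [Finite V] {u v : V} (h : u = v ∨ F u v) :
    (G.ofRel F).dist u v ≤ G.dist u v := by
  by_cases huv : u = v
  · subst huv
    simp [dist_self]
  · by_cases htop : G.dist u v = ⊤
    · rw [htop]
      exact le_top
    · have hadj : (G.ofRel F).Adj u v := ⟨h.resolve_left huv, dist_pos huv, htop⟩
      exact (dist_le_weight hadj).trans (ENNReal.coe_toNNReal htop).le

/-- Each edge raises the rank. This yields both acyclicity and non-reachability against the order.
-/
theorem rank_add_length_le {r : V → ℕ} (hF : ∀ u v, F u v → r u < r v) {u v : V}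
    (p : (G.ofRel F).Walk u v) : r u + p.length ≤ r v := by
  induction p with
  | nil => simp [Walk.length]
  | cons h p ih =>
    have := hF _ _ h.1
    simp only [Walk.length]
    omega

theorem rank_add_le_length {r : V → ℕ} (hF : ∀ u v, F u v → r v < r u) {u v : V}
    (p : (G.ofRel F).Walk u v) : r v + p.length ≤ r u := by
  induction p with
  | nil => simp [Walk.length]
  | cons h p ih =>
    have := hF _ _ h.1
    simp only [Walk.length]
    omega

theorem numEdges_ofRel_le [Finite V] :
    (G.ofRel F).numEdges ≤ {e : V × V | F e.1 e.2}.ncard :=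
  Set.ncard_le_ncard (fun _ h => h.1) (Set.toFinite _)

end WeightedDigraph

/-! ### A two-hop spanner on an interval of integers -/

section Hops

/-- The edges of a sparse two-hop spanner on the numbers below `2 ^ L`. -/
def IsHop (L i j : ℕ) : Prop :=
  ∃ l < L, j = (i / 2 ^ l + 1) * 2 ^ l ∨ i = j / 2 ^ l * 2 ^ l

/-- At the last dyadic level that separates `i` from `j`, they lie in consecutive blocks; the start
of the block of `j` is the midpoint. It may be `j` itself, but never `i`. -/
theorem exists_isHop {L i j : ℕ} (hij : i < j) (hj : j < 2 ^ L) :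
    ∃ m, i < m ∧ m ≤ j ∧ IsHop L i m ∧ IsHop L m j := by
  classical
  have hex : ∃ l, i / 2 ^ l = j / 2 ^ l :=
    ⟨L, by rw [Nat.div_eq_of_lt hj, Nat.div_eq_of_lt (hij.trans hj)]⟩
  obtain ⟨l, hl, hl', hlL⟩ : ∃ l, i / 2 ^ l ≠ j / 2 ^ l ∧
      i / 2 ^ (l + 1) = j / 2 ^ (l + 1) ∧ l < L := by
    have h1 := Nat.find_spec hex
    have h0 : Nat.find hex ≠ 0 := by
      intro h
      rw [h] at h1
      simp at h1
      omega
    obtain ⟨l, hl⟩ := Nat.exists_eq_succ_of_ne_zero h0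
    refine ⟨l, Nat.find_min hex (by omega), by rwa [hl] at h1, ?_⟩
    have : Nat.find hex ≤ L :=
      Nat.find_min' hex (by rw [Nat.div_eq_of_lt hj, Nat.div_eq_of_lt (hij.trans hj)])
    omega
  rw [pow_succ, ← Nat.div_div_eq_div_mul, ← Nat.div_div_eq_div_mul] at hl'
  have hle : i / 2 ^ l ≤ j / 2 ^ l := Nat.div_le_div_right hij.le
  have hsucc : j / 2 ^ l = i / 2 ^ l + 1 := by omega
  refine ⟨j / 2 ^ l * 2 ^ l, ?_, Nat.div_mul_le_self _ _, ⟨l, hlL, Or.inl (by rw [hsucc])⟩,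
    ⟨l, hlL, Or.inr rfl⟩⟩
  rw [hsucc]
  exact Nat.lt_mul_of_div_lt (Nat.lt_succ_self _) (by positivity)

end Hops

/-! ### Clusters of the ultrametric as intervals -/

section Clusters

open Finset

variable {V : Type*} [Fintype V] {d : V → V → ℝ≥0∞} {r : V → ℕ} {δ : V → V → ℝ≥0∞}

theorem exists_cluster_first (h : IsLaminar d univ r δ) :
    ∃ lo : ℝ≥0∞ → V → V, ∀ T x, δ x (lo T x) ≤ T ∧ ∀ z, δ x z ≤ T → r (lo T x) ≤ r z := by
  classical
  have : ∀ T x, ∃ y, δ x y ≤ T ∧ ∀ z, δ x z ≤ T → r y ≤ r z := by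
    intro T x
    obtain ⟨y, hy, hmin⟩ := exists_min_image (univ.filter (δ x · ≤ T)) r
      ⟨x, by simp [h.self x (mem_univ x)]⟩
    exact ⟨y, (mem_filter.1 hy).2, fun z hz => hmin z (mem_filter.2 ⟨mem_univ z, hz⟩)⟩
  choose lo hlo using this
  exact ⟨lo, hlo⟩

theorem exists_cluster_last (h : IsLaminar d univ r δ) :
    ∃ hi : ℝ≥0∞ → V → V, ∀ T x, δ x (hi T x) ≤ T ∧ ∀ z, δ x z ≤ T → r z ≤ r (hi T x) := by
  classical
  have : ∀ T x, ∃ y, δ x y ≤ T ∧ ∀ z, δ x z ≤ T → r z ≤ r y := by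
    intro T x
    obtain ⟨y, hy, hmax⟩ := exists_max_image (univ.filter (δ x · ≤ T)) r
      ⟨x, by simp [h.self x (mem_univ x)]⟩
    exact ⟨y, (mem_filter.1 hy).2, fun z hz => hmax z (mem_filter.2 ⟨mem_univ z, hz⟩)⟩
  choose hi hhi using this
  exact ⟨hi, hhi⟩

namespace IsLaminar

variable (h : IsLaminar d univ r δ)
include h

theorem comm (x y : V) : δ x y = δ y x := h.symm x (mem_univ x) y (mem_univ y)

theorem le_of_le_of_le {T : ℝ≥0∞} {x y z : V} (h1 : δ x y ≤ T) (h2 : δ y z ≤ T) : δ x z ≤ T :=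
  (h.ultra x (mem_univ x) y (mem_univ y) z (mem_univ z)).trans (max_le h1 h2)

theorem injective : Function.Injective r := fun x y =>
  h.rank_inj x (mem_univ x) y (mem_univ y)

theorem exists_rank_eq {m : ℕ} (hm : m < Fintype.card V) : ∃ z, r z = m := by
  have hinj : Function.Injective fun x : V =>
      (⟨r x, h.rank_lt x (mem_univ x)⟩ : Fin (Fintype.card V)) := fun x y hxy =>
    h.injective (Fin.mk.inj_iff.1 hxy)
  obtain ⟨z, hz⟩ := ((Fintype.bijective_iff_injective_and_card _).2 ⟨hinj, by simp⟩).2 ⟨m, hm⟩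
  exact ⟨z, Fin.mk.inj_iff.1 hz⟩

/-- Every point of an ultrametric ball is a centre of it, so `lo T` depends only on the cluster. -/
theorem first_eq {lo : ℝ≥0∞ → V → V}
    (hlo : ∀ T x, δ x (lo T x) ≤ T ∧ ∀ z, δ x z ≤ T → r (lo T x) ≤ r z) {T : ℝ≥0∞} {x y : V}
    (hxy : δ x y ≤ T) : lo T x = lo T y := by
  refine h.injective (le_antisymm ?_ ?_)
  · exact (hlo T x).2 _ (h.le_of_le_of_le hxy (hlo T y).1)
  · exact (hlo T y).2 _ (h.le_of_le_of_le (h.comm y x ▸ hxy) (hlo T x).1)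

theorem last_eq {hi : ℝ≥0∞ → V → V}
    (hhi : ∀ T x, δ x (hi T x) ≤ T ∧ ∀ z, δ x z ≤ T → r z ≤ r (hi T x)) {T : ℝ≥0∞} {x y : V}
    (hxy : δ x y ≤ T) : hi T x = hi T y := by
  refine h.injective (le_antisymm ?_ ?_)
  · exact (hhi T y).2 _ (h.le_of_le_of_le (h.comm y x ▸ hxy) (hhi T x).1)
  · exact (hhi T x).2 _ (h.le_of_le_of_le hxy (hhi T y).1)

theorem eq_of_le_zero (hd : ∀ x y, x ≠ y → 0 < d x y) {x y : V} (hxy : δ x y ≤ 0) : x = y := by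
  by_contra hne
  exact absurd ((hd x y hne).trans_le (h.le x (mem_univ x) y (mem_univ y))) (not_lt.2 hxy)

/-- Vertices in different clusters keep the order of these clusters. -/
theorem last_lt_first {T T' : ℝ≥0∞} {q p a b : V} (hqp : r q < r p) (ha : δ q a ≤ T)
    (hb : δ p b ≤ T') (hT : T < δ q p) (hT' : T' < δ q p) : r a < r b := by
  by_contra! hba
  -- If `a` is not before `p`, then `p` lies between `q` and `a`, which forces `δ q p ≤ T`.
  -- Otherwise `a` lies between `b` and `p`, so `δ a p ≤ T'`, and the ultrametric inequality through
  -- `a` contradicts both bounds.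
  rcases le_or_gt (r p) (r a) with hpa | hpa
  · have := h.convex q (mem_univ q) p (mem_univ p) a (mem_univ a) hqp.le hpa
    exact absurd (this.trans ha) (not_le.2 hT)
  · have h1 := h.convex' b (mem_univ b) a (mem_univ a) p (mem_univ p) hba hpa.le
    rw [h.comm b p] at h1
    have h2 := h.ultra q (mem_univ q) a (mem_univ a) p (mem_univ p)
    exact absurd (h2.trans (max_le_max ha (h1.trans hb))) (not_le.2 (max_lt hT hT'))

/-- Ranks fill an initial segment, so the midpoint is a vertex; it lies between `u` and `v`, and
convexity keeps both hops within `δ u v`. -/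
theorem exists_hop {L : ℕ} (hL : Fintype.card V ≤ 2 ^ L) {u v : V} (huv : r u < r v) :
    ∃ z, δ u z ≤ δ u v ∧ δ z v ≤ δ u v ∧ (r u < r z ∧ IsHop L (r u) (r z)) ∧
      (z = v ∨ r z < r v ∧ IsHop L (r z) (r v)) := by
  have hv := h.rank_lt v (mem_univ v)
  rw [card_univ] at hv
  obtain ⟨m, h1, h2, h3, h4⟩ := exists_isHop huv (hv.trans_le hL)
  obtain ⟨z, rfl⟩ := h.exists_rank_eq (h2.trans_lt hv)
  refine ⟨z, h.convex u (mem_univ u) z (mem_univ z) v (mem_univ v) h1.le h2,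
    h.convex' u (mem_univ u) z (mem_univ z) v (mem_univ v) h1.le h2, ⟨h1, h3⟩, ?_⟩
  rcases h2.eq_or_lt with e | e
  · exact Or.inl (h.injective e)
  · exact Or.inr ⟨e, h4⟩

end IsLaminar

end Clusters

/-! ### The forward and backward DAGs -/

namespace WeightedDigraph

open Finset

variable {V : Type*}

/-- The edges of the forward DAG: hops, and links from the last vertex of a cluster of the tail of
an edge of `G` to the first vertex of a cluster of its head. -/
def forwardRel (G : WeightedDigraph V) (r : V → ℕ) (L : ℕ) (S : Finset ℝ≥0∞)
    (lo hi : ℝ≥0∞ → V → V) (u v : V) : Prop :=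
  r u < r v ∧ (IsHop L (r u) (r v) ∨
    ∃ a b, G.Adj a b ∧ ∃ T ∈ S, ∃ T' ∈ S, u = hi T a ∧ v = lo T' b)

/-- The edges of the backward DAG: reversed hops. -/
def backwardRel (r : V → ℕ) (L : ℕ) (u v : V) : Prop :=
  r v < r u ∧ IsHop L (r v) (r u)

/-- The sum of the costs of the edges of a walk. -/
noncomputable def Walk.sumCost {G : WeightedDigraph V} (κ : V → V → ℝ≥0∞) :
    ∀ {u v : V}, G.Walk u v → ℝ≥0∞
  | _, _, .nil => 0
  | u, _, .cons (v := v) _ p => κ u v + p.sumCost κ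

variable {G : WeightedDigraph V} {r : V → ℕ} {δ : V → V → ℝ≥0∞} {L : ℕ}
  {S : Finset ℝ≥0∞} {lo hi : ℝ≥0∞ → V → V}

theorem isDAG_forward : (G.ofRel (G.forwardRel r L S lo hi)).IsDAG := fun v p => by
  have := rank_add_length_le (r := r) (fun _ _ h => h.1) p
  omega

theorem isDAG_backward : (G.ofRel (backwardRel r L)).IsDAG := fun v p => by
  have := rank_add_le_length (r := r) (fun _ _ h => h.1) p
  omega

variable [Fintype V]

theorem dist_forward_le (h : IsLaminar G.dist univ r δ) (hL : Fintype.card V ≤ 2 ^ L)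
    {T : ℝ≥0∞} {u v : V} (huv : r u ≤ r v) (hT : δ u v ≤ T) :
    (G.ofRel (G.forwardRel r L S lo hi)).dist u v ≤ 2 * T := by
  rcases huv.eq_or_lt with e | e
  · rw [h.injective e, dist_self]
    exact bot_le
  · obtain ⟨z, h1, h2, h3, h4⟩ := h.exists_hop hL e
    refine (dist_triangle u z v).trans ?_
    rw [two_mul]
    refine add_le_add ?_ ?_
    · refine (dist_ofRel_le (Or.inr ⟨h3.1, Or.inl h3.2⟩)).trans ?_
      exact (h.le u (mem_univ u) z (mem_univ z)).trans (h1.trans hT)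
    · refine (dist_ofRel_le (h4.imp_right fun h4 => ⟨h4.1, Or.inl h4.2⟩)).trans ?_
      exact (h.le z (mem_univ z) v (mem_univ v)).trans (h2.trans hT)

theorem dist_backward_le (h : IsLaminar G.dist univ r δ) (hL : Fintype.card V ≤ 2 ^ L)
    {u v : V} (huv : r v < r u) :
    (G.ofRel (backwardRel r L)).dist u v ≤ 2 * δ u v := by
  obtain ⟨z, h1, h2, h3, h4⟩ := h.exists_hop hL huv
  rw [h.comm v u] at h1 h2
  refine (dist_triangle u z v).trans ?_
  rw [two_mul]
  refine add_le_add ?_ ?_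
  · refine (dist_ofRel_le (h4.imp Eq.symm id)).trans ?_
    exact (h.le u (mem_univ u) z (mem_univ z)).trans (h.comm u z ▸ h2)
  · refine (dist_ofRel_le (F := backwardRel r L) (Or.inr h3)).trans ?_
    exact (h.le z (mem_univ z) v (mem_univ v)).trans (h.comm z v ▸ h1)

/-- The amount charged to a pair for its part of a detour in the forward DAG. -/
noncomputable def detourCost (G : WeightedDigraph V) (r : V → ℕ) (δ : V → V → ℝ≥0∞) (x y : V) :
    ℝ≥0∞ :=
  G.dist x y + 6 * (if r y < r x then δ x y else 0)

/-- Induction from the end of the walk. The start of the current `j`-cluster reaches `v` with `j` to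
spare, and this slack pays for entering a cluster at its first vertex. The second clause allows
leaving any larger cluster that does not contain `v` through its last vertex. -/
theorem exists_cluster_of_walk (h : IsLaminar G.dist univ r δ) (hL : Fintype.card V ≤ 2 ^ L)
    (hlo : ∀ T x, δ x (lo T x) ≤ T ∧ ∀ z, δ x z ≤ T → r (lo T x) ≤ r z)
    (hhi : ∀ T x, δ x (hi T x) ≤ T ∧ ∀ z, δ x z ≤ T → r z ≤ r (hi T x))
    (hS0 : 0 ∈ S) (hS : ∀ x y, δ x y ≠ ⊤ → ∃ T ∈ S, δ x y ≤ T ∧ T ≤ 2 * δ x y)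
    {p v : V} (P : G.Walk p v) {D : WeightedDigraph V}
    (hD : D = G.ofRel (G.forwardRel r L S lo hi)) :
    ∃ j ∈ S, D.dist (lo j p) v + j ≤ P.sumCost (detourCost G r δ) ∧
      ∀ i ∈ S, j ≤ i →
        δ p v ≤ i ∨ D.dist (hi i p) v ≤ P.sumCost (detourCost G r δ) + i := by
  have hself : ∀ x, δ x x = 0 := fun x => h.self x (mem_univ x)
  have hlo0 : ∀ x, lo 0 x = x := fun x =>
    (h.eq_of_le_zero (fun _ _ => dist_pos) (hlo 0 x).1).symm
  have hhi0 : ∀ x, hi 0 x = x := fun x =>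
    (h.eq_of_le_zero (fun _ _ => dist_pos) (hhi 0 x).1).symm
  have hle : ∀ x y, G.dist x y ≤ δ x y := fun x y => h.le x (mem_univ x) y (mem_univ y)
  induction P with
  | @nil u =>
    refine ⟨0, hS0, ?_, fun i _ _ => Or.inl ?_⟩
    · simp [hlo0, dist_self]
    · simp [hself]
  | @cons q p v e P ih =>
    obtain ⟨j, hj, h1, h2⟩ := ih
    have hcost : (Walk.cons e P).sumCost (detourCost G r δ) =
      detourCost G r δ q p + P.sumCost (detourCost G r δ) := rfl
    rw [hcost]
    set Λ := P.sumCost (detourCost G r δ) with hΛ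
    set κ := detourCost G r δ q p with hκ
    have hΛκ : Λ ≤ κ + Λ := le_add_self
    -- At scales that merge `q` and `p`, both have the same cluster, hence the same last vertex.
    have inherit : ∀ i ∈ S, j ≤ i → δ q p ≤ i → δ q v ≤ i ∨ D.dist (hi i q) v ≤ κ + Λ + i := by
      intro i hi' hji hqi
      rcases h2 i hi' hji with h3 | h3
      · exact Or.inl (h.le_of_le_of_le hqi h3)
      · rw [h.last_eq hhi hqi]
        exact Or.inr (h3.trans (add_le_add_left hΛκ i))
    rcases le_or_gt (δ q p) j with hjq | hjq
    · refine ⟨j, hj, ?_, fun i hi' hji => inherit i hi' hji (hjq.trans hji)⟩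
      rw [h.first_eq hlo hjq]
      exact h1.trans hΛκ
    · rcases lt_trichotomy (r q) (r p) with hqp | hqp | hqp
      -- A forward edge between distinct clusters: the link detours by at most `i` at its tail and
      -- `j` at its head, and the slack absorbs `j`. Afterwards the scale resets to 0, where the
      -- cluster of `q` is `q` alone.
      · have link : ∀ i ∈ S, i < δ q p → D.dist (hi i q) v ≤ κ + Λ + i := by
          intro i hi' hiq
          have hlt : r (hi i q) < r (lo j p) := h.last_lt_first hqp (hhi i q).1 (hlo j p).1
            hiq hjq
          have hedge : D.dist (hi i q) (lo j p) ≤ i + (κ + j) := by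
            rw [hD]
            refine (dist_ofRel_le (Or.inr ⟨hlt, Or.inr ⟨q, p, e, i, hi', j, hj, rfl, rfl⟩⟩)).trans ?_
            refine (dist_triangle _ q _).trans (add_le_add ?_ ?_)
            · exact (hle _ _).trans (h.comm q (hi i q) ▸ (hhi i q).1)
            · refine (dist_triangle _ p _).trans (add_le_add le_self_add ?_)
              exact (hle _ _).trans (hlo j p).1
          calc D.dist (hi i q) v ≤ D.dist (hi i q) (lo j p) + D.dist (lo j p) v :=
                dist_triangle _ _ _
            _ ≤ i + (κ + j) + D.dist (lo j p) v := add_le_add_left hedge _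
            _ = κ + (D.dist (lo j p) v + j) + i := by ring
            _ ≤ κ + Λ + i := by gcongr
        refine ⟨0, hS0, ?_, fun i hi' _ => ?_⟩
        · have := link 0 hS0 (bot_le.trans_lt hjq)
          rw [hhi0] at this
          rw [hlo0]
          simpa using this
        · rcases le_or_gt (δ q p) i with hiq | hiq
          · exact inherit i hi' (hjq.le.trans hiq) hiq
          · exact Or.inr (link i hi' hiq)
      · rw [h.injective hqp, hself] at hjq
        exact absurd hjq not_lt_bot
      · have htop : δ q p ≠ ⊤ := h.ne_top q (mem_univ q) p (mem_univ p) hqp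
          (dist_ne_top_iff.2 ⟨.cons e .nil⟩)
        -- A backward edge: pass to a scale that merges `q` and `p`. Hopping from its first vertex
        -- costs `2T` and the new slack costs `T`; as `T ≤ 2 * δ q p`, this is the `6` in
        -- `detourCost`.
        obtain ⟨T, hT, hT1, hT2⟩ := hS q p htop
        refine ⟨T, hT, ?_, fun i hi' hTi =>
          inherit i hi' (hjq.le.trans (hT1.trans hTi)) (hT1.trans hTi)⟩
        rw [h.first_eq hlo hT1]
        have hjT : j ≤ T := hjq.le.trans hT1
        have hhop : D.dist (lo T p) (lo j p) ≤ 2 * T := by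
          rw [hD]
          refine dist_forward_le h hL ((hlo T p).2 _ ((hlo j p).1.trans hjT)) ?_
          exact h.le_of_le_of_le (h.comm p (lo T p) ▸ (hlo T p).1) ((hlo j p).1.trans hjT)
        have hκ6 : 6 * δ q p ≤ κ := by
          rw [hκ, detourCost, if_pos hqp]
          exact le_add_self
        calc D.dist (lo T p) v + T ≤ D.dist (lo T p) (lo j p) + D.dist (lo j p) v + T :=
              add_le_add_left (dist_triangle _ _ _) _
          _ ≤ 2 * T + D.dist (lo j p) v + T := by gcongr
          _ = 3 * T + D.dist (lo j p) v := by ring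
          _ ≤ 3 * (2 * δ q p) + Λ := by
              gcongr
              exact le_self_add.trans h1
          _ = 6 * δ q p + Λ := by ring
          _ ≤ κ + Λ := by gcongr

/-- The invariant is used with `i = j`: if `v` is in the `j`-cluster of `u`, hops suffice; otherwise
hop to its last vertex for `2j` and continue. The slack shows that `j` is at most the cost of the
walk. -/
theorem dist_forward_le_sumCost (h : IsLaminar G.dist univ r δ) (hL : Fintype.card V ≤ 2 ^ L)
    (hlo : ∀ T x, δ x (lo T x) ≤ T ∧ ∀ z, δ x z ≤ T → r (lo T x) ≤ r z)
    (hhi : ∀ T x, δ x (hi T x) ≤ T ∧ ∀ z, δ x z ≤ T → r z ≤ r (hi T x))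
    (hS0 : 0 ∈ S) (hS : ∀ x y, δ x y ≠ ⊤ → ∃ T ∈ S, δ x y ≤ T ∧ T ≤ 2 * δ x y)
    {u v : V} (P : G.Walk u v) (huv : r u ≤ r v) :
    (G.ofRel (G.forwardRel r L S lo hi)).dist u v ≤ 4 * P.sumCost (detourCost G r δ) := by
  obtain ⟨j, hj, h1, h2⟩ := exists_cluster_of_walk h hL hlo hhi hS0 hS P rfl
  have hjP : j ≤ P.sumCost (detourCost G r δ) := le_add_self.trans h1
  rcases h2 j hj le_rfl with h3 | h3
  · refine (dist_forward_le h hL huv h3).trans ?_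
    calc 2 * j ≤ 2 * P.sumCost (detourCost G r δ) := by gcongr
      _ ≤ 4 * P.sumCost (detourCost G r δ) := by
        gcongr
        norm_num
  · have h4 := dist_forward_le (S := S) (lo := lo) (hi := hi) h hL
      ((hhi j u).2 u (by simp [h.self u (mem_univ u)])) (hhi j u).1
    calc _ ≤ _ := dist_triangle u (hi j u) v
      _ ≤ 2 * j + (P.sumCost (detourCost G r δ) + j) := add_le_add h4 h3
      _ = 3 * j + P.sumCost (detourCost G r δ) := by ring
      _ ≤ 3 * P.sumCost (detourCost G r δ) + P.sumCost (detourCost G r δ) := by gcongr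
      _ = 4 * P.sumCost (detourCost G r δ) := by ring

theorem ncard_isHop_le (h : IsLaminar G.dist univ r δ) :
    {e : V × V | IsHop L (r e.1) (r e.2)}.ncard ≤ 2 * (Fintype.card V * L) := by
  classical
  let A : Finset (ℕ × ℕ) := (range (Fintype.card V) ×ˢ range L).image
    fun q => (q.1, (q.1 / 2 ^ q.2 + 1) * 2 ^ q.2)
  let B : Finset (ℕ × ℕ) := (range (Fintype.card V) ×ˢ range L).image
    fun q => (q.1 / 2 ^ q.2 * 2 ^ q.2, q.1)
  have hr : ∀ x, r x < Fintype.card V := fun x => h.rank_lt x (mem_univ x)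
  have h1 : {e : V × V | IsHop L (r e.1) (r e.2)}.ncard ≤ ((A ∪ B : Finset (ℕ × ℕ)) :
      Set (ℕ × ℕ)).ncard := by
    refine Set.ncard_le_ncard_of_injOn (fun e => (r e.1, r e.2)) ?_ ?_ (finite_toSet _)
    · rintro ⟨x, y⟩ ⟨l, hl, hxy | hxy⟩
      · refine mem_union_left _ (mem_image.2 ⟨(r x, l), ?_, ?_⟩)
        · simp [hr x, hl]
        · exact Prod.ext rfl hxy.symm
      · refine mem_union_right _ (mem_image.2 ⟨(r y, l), ?_, ?_⟩)
        · simp [hr y, hl]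
        · exact Prod.ext hxy.symm rfl
    · rintro ⟨x, y⟩ _ ⟨x', y'⟩ _ he
      have he' := Prod.mk_inj.1 he
      exact Prod.ext (h.injective he'.1) (h.injective he'.2)
  rw [Set.ncard_coe_finset] at h1
  have hA : #A ≤ Fintype.card V * L := card_image_le.trans (by simp)
  have hB : #B ≤ Fintype.card V * L := card_image_le.trans (by simp)
  have := card_union_le A B
  omega

/-- A link is determined by an edge and two scales. -/
theorem ncard_link_le :
    {e : V × V | ∃ a b, G.Adj a b ∧ ∃ T ∈ S, ∃ T' ∈ S, e.1 = hi T a ∧ e.2 = lo T' b}.ncard ≤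
      G.numEdges * (#S * #S) := by
  have hsub : {e : V × V | ∃ a b, G.Adj a b ∧ ∃ T ∈ S, ∃ T' ∈ S, e.1 = hi T a ∧ e.2 = lo T' b} ⊆
      (fun q : (V × V) × (ℝ≥0∞ × ℝ≥0∞) => (hi q.2.1 q.1.1, lo q.2.2 q.1.2)) ''
        ({e : V × V | G.Adj e.1 e.2} ×ˢ ((S : Set ℝ≥0∞) ×ˢ (S : Set ℝ≥0∞))) := by
    rintro ⟨x, y⟩ ⟨a, b, hab, T, hT, T', hT', rfl, rfl⟩
    exact ⟨((a, b), (T, T')), ⟨hab, hT, hT'⟩, rfl⟩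
  have hfin : ({e : V × V | G.Adj e.1 e.2} ×ˢ ((S : Set ℝ≥0∞) ×ˢ (S : Set ℝ≥0∞))).Finite :=
    (Set.toFinite _).prod (S.finite_toSet.prod S.finite_toSet)
  refine (Set.ncard_le_ncard hsub (hfin.image _)).trans ((Set.ncard_image_le hfin).trans ?_)
  rw [Set.ncard_prod, Set.ncard_prod, Set.ncard_coe_finset]
  rfl

theorem numEdges_backward_le (h : IsLaminar G.dist univ r δ) :
    (G.ofRel (backwardRel r L)).numEdges ≤ 2 * (Fintype.card V * L) := by
  refine numEdges_ofRel_le.trans (le_trans ?_ (ncard_isHop_le h))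
  refine Set.ncard_le_ncard_of_injOn Prod.swap (fun _ he => he.2) ?_ (Set.toFinite _)
  exact fun _ _ _ _ he => Prod.swap_injective he

theorem numEdges_forward_le (h : IsLaminar G.dist univ r δ) :
    (G.ofRel (G.forwardRel r L S lo hi)).numEdges ≤
      2 * (Fintype.card V * L) + G.numEdges * (#S * #S) := by
  refine numEdges_ofRel_le.trans (le_trans ?_ (add_le_add (ncard_isHop_le h)
    (ncard_link_le (S := S) (lo := lo) (hi := hi))))
  exact (Set.ncard_le_ncard (fun _ he => he.2) (Set.toFinite _)).trans (Set.ncard_union_le _ _)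

end WeightedDigraph

/-! ### Scales, expectations and the embedding -/

namespace WeightedDigraph

open Finset

theorem logb_bounds {n : ℕ} (hn : 3 ≤ n) :
    3 / 2 ≤ Real.logb 2 n ∧ 1 / 2 ≤ Real.logb 2 (Real.logb 2 n) ∧
      Real.log (2 * n) ≤ 2 * Real.logb 2 n ∧
      0 ≤ Real.log (Real.logb 2 (2 * n)) ∧
      Real.log (Real.logb 2 (2 * n)) ≤ 3 * Real.logb 2 (Real.logb 2 n) ∧
      (Nat.log 2 n : ℝ) ≤ Real.logb 2 n := by
  have hn' : (3 : ℝ) ≤ n := by exact_mod_cast hn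
  have hlog : ∀ x : ℝ, 1 ≤ x → Real.log x ≤ Real.logb 2 x := by
    intro x hx
    rw [Real.logb, le_div_iff₀ (Real.log_pos one_lt_two)]
    have := Real.log_two_lt_d9
    nlinarith [Real.log_nonneg hx]
  -- From `3 ^ 2 ≥ 2 ^ 3`.
  have h1 : 3 / 2 ≤ Real.logb 2 n := by
    have : Real.logb 2 ((n : ℝ) ^ 2) = 2 * Real.logb 2 n := by
      rw [Real.logb_pow]
      norm_num
    have h3 : (3 : ℝ) ≤ Real.logb 2 ((n : ℝ) ^ 2) := by
      rw [Real.le_logb_iff_rpow_le one_lt_two (by positivity)]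
      norm_num
      nlinarith
    linarith
  have h2 : 1 / 2 ≤ Real.logb 2 (Real.logb 2 n) := by
    have : Real.logb 2 ((Real.logb 2 n) ^ 2) = 2 * Real.logb 2 (Real.logb 2 n) := by
      rw [Real.logb_pow]
      norm_num
    have h3 : (1 : ℝ) ≤ Real.logb 2 ((Real.logb 2 n) ^ 2) := by
      rw [Real.le_logb_iff_rpow_le one_lt_two (by positivity), Real.rpow_one]
      nlinarith
    linarith
  have e : Real.logb 2 (2 * n) = 1 + Real.logb 2 n := by
    rw [Real.logb_mul (by norm_num) (by linarith), Real.logb_self_eq_one one_lt_two]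
  have h5 : Real.logb 2 (2 * Real.logb 2 n) = 1 + Real.logb 2 (Real.logb 2 n) := by
    rw [Real.logb_mul (by norm_num) (by linarith), Real.logb_self_eq_one one_lt_two]
  refine ⟨h1, h2, ?_, ?_, ?_, ?_⟩
  · have := hlog (2 * n) (by linarith)
    linarith
  · exact Real.log_nonneg (by linarith)
  · have h6 := hlog (Real.logb 2 (2 * n)) (by linarith)
    have h7 : Real.logb 2 (Real.logb 2 (2 * n)) ≤ Real.logb 2 (2 * Real.logb 2 n) :=
      Real.logb_le_logb_of_le one_lt_two (by linarith) (by linarith)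
    linarith
  · rw [Real.le_logb_iff_rpow_le one_lt_two (by linarith), Real.rpow_natCast]
    exact_mod_cast Nat.pow_log_le_self 2 (by omega)

variable {V : Type*} {G : WeightedDigraph V}

/-- If the aspect ratio is polynomial, then logarithmically many thresholds approximate all finite
distances. -/
theorem exists_thresholds {n k : ℕ} (h : G.aspectRatio ≤ (n : ℝ≥0∞) ^ k) :
    ∃ S : Finset ℝ≥0∞, 0 ∈ S ∧ #S ≤ k * (Nat.log 2 n + 1) + 2 ∧
      ∀ x y, G.dist x y ≠ ⊤ → ∃ T ∈ S, G.dist x y ≤ T ∧ T ≤ 2 * G.dist x y := by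
  classical
  unfold aspectRatio at h
  set m := ⨅ (u : V) (v : V) (_ : u ≠ v ∧ G.Reachable u v), G.dist u v with hm
  set K := k * (Nat.log 2 n + 1) with hK
  -- Doublings of the least distance `m`; since `n ^ k ≤ 2 ^ K`, the last one covers the largest
  -- finite distance.
  refine ⟨insert 0 ((range (K + 1)).image fun i => 2 ^ i * m), mem_insert_self _ _, ?_, ?_⟩
  · refine (card_insert_le _ _).trans ?_
    have : #((range (K + 1)).image fun i => 2 ^ i * m) ≤ K + 1 := card_image_le.trans (by simp)
    omega
  · intro x y hxy
    by_cases hne : x = y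
    · subst hne
      exact ⟨0, mem_insert_self _ _, by simp [dist_self]⟩
    have hp : x ≠ y ∧ G.Reachable x y := ⟨hne, dist_ne_top_iff.1 hxy⟩
    have hmle : m ≤ G.dist x y := (iInf_le _ x).trans ((iInf_le _ y).trans (iInf_le _ hp))
    have hsup : G.dist x y ≤ ⨆ (u : V) (v : V) (_ : u ≠ v ∧ G.Reachable u v), G.dist u v :=
      le_trans (le_trans (le_iSup (fun _ : x ≠ y ∧ G.Reachable x y => G.dist x y) hp)
        (le_iSup (fun v => ⨆ _ : x ≠ v ∧ G.Reachable x v, G.dist x v) y))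
        (le_iSup (fun u => ⨆ (v : V) (_ : u ≠ v ∧ G.Reachable u v), G.dist u v) x)
    have hmtop : m ≠ ⊤ := ne_top_of_le_ne_top hxy hmle
    rw [ENNReal.div_le_iff_le_mul (Or.inr (by finiteness)) (Or.inl hmtop)] at h
    have hpow : ((n : ℝ≥0∞)) ^ k ≤ 2 ^ K := by
      have : n ≤ 2 ^ (Nat.log 2 n + 1) := (Nat.lt_pow_succ_log_self one_lt_two n).le
      rw [hK, mul_comm, pow_mul]
      exact_mod_cast Nat.pow_le_pow_left this k
    have hex : ∃ i, G.dist x y ≤ 2 ^ i * m :=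
      ⟨K, (hsup.trans h).trans (mul_le_mul_left hpow m)⟩
    have hle : Nat.find hex ≤ K := Nat.find_min' hex ((hsup.trans h).trans (mul_le_mul_left hpow m))
    refine ⟨2 ^ Nat.find hex * m, mem_insert_of_mem (mem_image.2 ⟨Nat.find hex, ?_, rfl⟩),
      Nat.find_spec hex, ?_⟩
    · exact mem_range.2 (Nat.lt_succ_of_le hle)
    · rcases Nat.eq_zero_or_eq_succ_pred (Nat.find hex) with h0 | h0
      · rw [h0, pow_zero, one_mul, two_mul]
        exact hmle.trans le_self_add
      · have h1 := Nat.find_min hex (m := (Nat.find hex).pred) (by omega)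
        rw [h0, Nat.succ_eq_add_one, pow_succ', mul_assoc]
        exact mul_le_mul_right (not_le.1 h1).le 2

theorem tsum_sumCost_le {O : Type*} (P : PMF O) {κ : O → V → V → ℝ≥0∞} {t : ℝ≥0∞}
    (hκ : ∀ x y, G.dist x y ≠ ⊤ → ∑' o, P o * κ o x y ≤ t * G.dist x y)
    {u v : V} (p : G.Walk u v) : ∑' o, P o * p.sumCost (κ o) ≤ t * p.totalWeight := by
  induction p with
  | nil => simp [Walk.sumCost]
  | @cons u v w h p ih =>
    simp only [Walk.sumCost, Walk.totalWeight, mul_add, ENNReal.tsum_add, ENNReal.coe_add]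
    refine add_le_add ((hκ u v (dist_ne_top_iff.2 ⟨.cons h .nil⟩)).trans ?_) ih
    exact mul_le_mul_right (dist_le_weight h) t

theorem tsum_map_mul {O A : Type*} (P : PMF O) (f : O → A) (g : A → ℝ≥0∞) :
    ∑' a, P.map f a * g a = ∑' o, P o * g (f o) := by
  classical
  simp only [PMF.map_apply, ← ENNReal.tsum_mul_right]
  rw [ENNReal.tsum_comm]
  refine tsum_congr fun o => ?_
  rw [tsum_eq_single (f o)]
  · simp
  · intro a ha
    simp [ha]

variable {r : V → ℕ} {δ : V → V → ℝ≥0∞} {L : ℕ} {S : Finset ℝ≥0∞} {lo hi : ℝ≥0∞ → V → V}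

theorem not_reachable_forward {u v : V} (huv : r v < r u) :
    ¬ (G.ofRel (G.forwardRel r L S lo hi)).Reachable u v := by
  rintro ⟨p⟩
  have := rank_add_length_le (r := r) (fun _ _ h => h.1) p
  omega

theorem not_reachable_backward {u v : V} (huv : r u < r v) :
    ¬ (G.ofRel (backwardRel r L)).Reachable u v := by
  rintro ⟨p⟩
  have := rank_add_le_length (r := r) (fun _ _ h => h.1) p
  omega

variable [Fintype V]

theorem sumCost_ne_top (h : IsLaminar G.dist univ r δ) {u v : V} (P : G.Walk u v) :
    P.sumCost (detourCost G r δ) ≠ ⊤ := by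
  induction P with
  | nil => simp [Walk.sumCost]
  | @cons u v w e P ih =>
    have hd : G.dist u v ≠ ⊤ := dist_ne_top_iff.2 ⟨.cons e .nil⟩
    refine ENNReal.add_ne_top.2 ⟨ENNReal.add_ne_top.2 ⟨hd, ?_⟩, ih⟩
    split_ifs with huv
    · exact ENNReal.mul_ne_top (by norm_num) (h.ne_top u (mem_univ u) v (mem_univ v) huv hd)
    · simp

/-- In the direction of the order, the distance bound is finite, hence reachability; ranks exclude
it in the other DAG. -/
theorem reachable_xor (h : IsLaminar G.dist univ r δ) (hL : Fintype.card V ≤ 2 ^ L)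
    (hlo : ∀ T x, δ x (lo T x) ≤ T ∧ ∀ z, δ x z ≤ T → r (lo T x) ≤ r z)
    (hhi : ∀ T x, δ x (hi T x) ≤ T ∧ ∀ z, δ x z ≤ T → r z ≤ r (hi T x))
    (hS0 : 0 ∈ S) (hS : ∀ x y, δ x y ≠ ⊤ → ∃ T ∈ S, δ x y ≤ T ∧ T ≤ 2 * δ x y)
    {u v : V} (huv : u ≠ v) (hr : G.Reachable u v) :
    Xor ((G.ofRel (G.forwardRel r L S lo hi)).Reachable u v)
      ((G.ofRel (backwardRel r L)).Reachable u v) := by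
  have hne : r u ≠ r v := fun e => huv (h.injective e)
  rcases hne.lt_or_gt with hlt | hlt
  · refine Or.inl ⟨?_, not_reachable_backward hlt⟩
    obtain ⟨p⟩ := hr
    exact dist_ne_top_iff.1 (ne_top_of_le_ne_top
      (ENNReal.mul_ne_top (by norm_num) (sumCost_ne_top h p))
      (dist_forward_le_sumCost h hL hlo hhi hS0 hS p hlt.le))
  · refine Or.inr ⟨?_, not_reachable_forward hlt⟩
    refine dist_ne_top_iff.1 (ne_top_of_le_ne_top
      (ENNReal.mul_ne_top (by norm_num) ?_) (dist_backward_le h hL hlt))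
    exact h.ne_top u (mem_univ u) v (mem_univ v) hlt (dist_ne_top_iff.2 hr)

open Classical in
theorem reachable_dist_add_le (h : IsLaminar G.dist univ r δ) (hL : Fintype.card V ≤ 2 ^ L)
    (hlo : ∀ T x, δ x (lo T x) ≤ T ∧ ∀ z, δ x z ≤ T → r (lo T x) ≤ r z)
    (hhi : ∀ T x, δ x (hi T x) ≤ T ∧ ∀ z, δ x z ≤ T → r z ≤ r (hi T x))
    (hS0 : 0 ∈ S) (hS : ∀ x y, δ x y ≠ ⊤ → ∃ T ∈ S, δ x y ≤ T ∧ T ≤ 2 * δ x y)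
    {u v : V} (p : G.Walk u v) :
    (if (G.ofRel (G.forwardRel r L S lo hi)).Reachable u v then
        (G.ofRel (G.forwardRel r L S lo hi)).dist u v else 0) +
      (if (G.ofRel (backwardRel r L)).Reachable u v then
        (G.ofRel (backwardRel r L)).dist u v else 0) ≤
    4 * p.sumCost (detourCost G r δ) + 2 * (if r v < r u then δ u v else 0) := by
  rcases lt_trichotomy (r u) (r v) with hlt | heq | hlt
  · rw [if_neg (not_reachable_backward hlt), add_zero]
    refine le_trans ?_ le_self_add
    split_ifs
    · exact dist_forward_le_sumCost h hL hlo hhi hS0 hS p hlt.le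
    · exact bot_le
  · obtain rfl := h.injective heq
    simp [dist_self]
  · rw [if_neg (not_reachable_forward hlt), zero_add, if_pos hlt]
    refine le_trans ?_ le_add_self
    split_ifs
    · exact dist_backward_le h hL hlt
    · exact bot_le

/-- A stochastic embedding whose distortion and size are stated in explicit terms. -/
theorem exists_isStochasticEmbedding [Nonempty V] {N : ℕ} {K : ℝ}
    (hK : 4 * Real.log (Real.logb 2 (2 * Fintype.card V)) < K) (hK0 : 0 ≤ K)
    (hL : Fintype.card V ≤ 2 ^ L) (hS0 : 0 ∈ S)
    (hS : ∀ x y, G.dist x y ≠ ⊤ → ∃ T ∈ S, G.dist x y ≤ T ∧ T ≤ 2 * G.dist x y)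
    (hSN : #S ≤ N) :
    ∃ P : PMF (WeightedDigraph V × WeightedDigraph V), G.IsStochasticEmbedding P ∧
      (∀ u v, G.Reachable u v → expectedDist P u v ≤
        (4 + 26 * ENNReal.ofReal (2 * K * Real.log (2 * Fintype.card V))) * G.dist u v) ∧
      ∀ D ∈ P.support,
        D.1.numEdges ≤ 2 * (Fintype.card V * L) + G.numEdges * (N * N) ∧
        D.2.numEdges ≤ 2 * (Fintype.card V * L) := by
  classical
  obtain ⟨Q, hQ⟩ := exists_pmf_laminarOrder (d := G.dist) dist_self (fun _ _ => dist_pos)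
    dist_triangle hK hK0
  set t := ENNReal.ofReal (2 * K * Real.log (2 * Fintype.card V)) with ht
  choose lo hlo using fun o : LaminarOrder G.dist => exists_cluster_first o.2
  choose hi hhi using fun o : LaminarOrder G.dist => exists_cluster_last o.2
  -- Values of `δ` are values of `G.dist`, so one set of scales serves every order.
  have hS' : ∀ (o : LaminarOrder G.dist) x y, o.1.2 x y ≠ ⊤ →
      ∃ T ∈ S, o.1.2 x y ≤ T ∧ T ≤ 2 * o.1.2 x y := by
    intro o x y hxy
    obtain ⟨a, b, hab⟩ := o.2.exists_eq x (mem_univ x) y (mem_univ y)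
    rw [hab] at hxy ⊢
    exact hS a b hxy
  let f : LaminarOrder G.dist → WeightedDigraph V × WeightedDigraph V := fun o =>
    (G.ofRel (G.forwardRel o.1.1 L S (lo o) (hi o)), G.ofRel (backwardRel o.1.1 L))
  have hsupp : ∀ D ∈ (Q.map f).support, ∃ o, f o = D := fun D hD => by
    obtain ⟨o, _, ho⟩ := (PMF.mem_support_map_iff f Q D).1 hD
    exact ⟨o, ho⟩
  refine ⟨Q.map f, ⟨?_, ?_, ?_⟩, ?_, ?_⟩
  · intro D hD
    obtain ⟨o, rfl⟩ := hsupp D hD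
    exact ⟨isDAG_forward, isDAG_backward⟩
  · intro D hD u v
    obtain ⟨o, rfl⟩ := hsupp D hD
    exact le_min (dist_le_dist_ofRel u v) (dist_le_dist_ofRel u v)
  · intro D hD u v huv hr
    obtain ⟨o, rfl⟩ := hsupp D hD
    exact reachable_xor o.2 hL (hlo o) (hhi o) hS0 (hS' o) huv hr
  · intro u v huv
    have hfin := dist_ne_top_iff.2 huv
    have hdet : ∀ x y, G.dist x y ≠ ⊤ →
        ∑' o, Q o * detourCost G o.1.1 o.1.2 x y ≤ (1 + 6 * t) * G.dist x y := by
      intro x y hxy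
      have e : ∀ o : LaminarOrder G.dist, Q o * detourCost G o.1.1 o.1.2 x y =
          Q o * G.dist x y + 6 * (Q o * (if o.1.1 y < o.1.1 x then o.1.2 x y else 0)) := by
        intro o
        rw [detourCost]
        ring
      rw [tsum_congr e, ENNReal.tsum_add, ENNReal.tsum_mul_right, ENNReal.tsum_mul_left,
        PMF.tsum_coe, add_mul, mul_assoc]
      gcongr
      exact hQ x y hxy
    have hwalk : ∀ p : G.Walk u v, expectedDist (Q.map f) u v ≤ (4 + 26 * t) * p.totalWeight := by
      intro p
      have e : ∀ o : LaminarOrder G.dist, Q o * (4 * p.sumCost (detourCost G o.1.1 o.1.2) +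
          2 * (if o.1.1 v < o.1.1 u then o.1.2 u v else 0)) =
          4 * (Q o * p.sumCost (detourCost G o.1.1 o.1.2)) +
          2 * (Q o * (if o.1.1 v < o.1.1 u then o.1.2 u v else 0)) := fun o => by ring
      calc expectedDist (Q.map f) u v
          = ∑' o, Q o * ((if (f o).1.Reachable u v then (f o).1.dist u v else 0) +
              (if (f o).2.Reachable u v then (f o).2.dist u v else 0)) :=
            tsum_map_mul Q f fun D => (if D.1.Reachable u v then D.1.dist u v else 0) +
              (if D.2.Reachable u v then D.2.dist u v else 0)
        _ ≤ ∑' o, Q o * (4 * p.sumCost (detourCost G o.1.1 o.1.2) +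
              2 * (if o.1.1 v < o.1.1 u then o.1.2 u v else 0)) :=
            ENNReal.tsum_le_tsum fun o => mul_le_mul_right
              (reachable_dist_add_le o.2 hL (hlo o) (hhi o) hS0 (hS' o) p) _
        _ ≤ 4 * ((1 + 6 * t) * p.totalWeight) + 2 * (t * p.totalWeight) := by
            rw [tsum_congr e, ENNReal.tsum_add, ENNReal.tsum_mul_left, ENNReal.tsum_mul_left]
            gcongr
            · exact tsum_sumCost_le Q hdet p
            · exact (hQ u v hfin).trans (mul_le_mul_right (dist_le_totalWeight p) t)
        _ = (4 + 26 * t) * p.totalWeight := by ring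
    -- The bound holds for each walk, with `26 = 4 * 6 + 2`; a nonzero finite factor commutes with
    -- the infimum over walks.
    have ht0 : (4 + 26 * t) ≠ 0 := by simp
    have htt : (4 + 26 * t) ≠ ⊤ := by
      rw [ht]
      finiteness
    unfold dist
    rw [ENNReal.mul_iInf_of_ne ht0 htt]
    exact le_iInf hwalk
  · intro D hD
    obtain ⟨o, rfl⟩ := hsupp D hD
    exact ⟨(numEdges_forward_le o.2).trans (by gcongr), numEdges_backward_le o.2⟩

end WeightedDigraph

/-! ### The constants -/

theorem theorem4p1 (k : ℕ) :
    ∃ C : ℝ, 0 < C ∧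
      ∀ (V : Type*) [Fintype V] (G : WeightedDigraph V) (n m : ℕ),
        Fintype.card V = n → G.numEdges = m → 3 ≤ n → G.aspectRatio ≤ (n : ℝ≥0∞) ^ k →
        ∃ 𝒟 : PMF (WeightedDigraph V × WeightedDigraph V),
          G.IsStochasticEmbedding 𝒟 ∧
          G.HasExpectedDistortion 𝒟
            (ENNReal.ofReal (C * (Real.logb 2 n * Real.logb 2 (Real.logb 2 n)))) ∧
          ∀ D ∈ 𝒟.support,
            (D.1.numEdges : ℝ) ≤ C * (n * Real.logb 2 n + m * Real.logb 2 n ^ 2) ∧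
            (D.2.numEdges : ℝ) ≤ C * (n * Real.logb 2 n + m * Real.logb 2 n ^ 2) := by
  -- With `x = log₂ n` and `y = log₂ log₂ n`, the distortion is at most `4 + 26 * 56xy`, and there
  -- are at most `(2k + 2)x` scales, whose square multiplies `m`.
  refine ⟨2000 + (2 * k + 2) ^ 2, by positivity, ?_⟩
  intro V _ G n m hn hm hn3 hasp
  have : Nonempty V := Fintype.card_pos_iff.1 (by omega)
  obtain ⟨S, hS0, hSN, hS⟩ := WeightedDigraph.exists_thresholds hasp
  obtain ⟨h1, h2, h3, h4, h5, h6⟩ := WeightedDigraph.logb_bounds hn3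
  set x := Real.logb 2 n with hx
  set y := Real.logb 2 x with hy
  set z := Real.log (Real.logb 2 (2 * n)) with hz
  have hL : Fintype.card V ≤ 2 ^ (Nat.log 2 n + 1) := by
    rw [hn]
    exact (Nat.lt_pow_succ_log_self one_lt_two n).le
  obtain ⟨P, hP, hdist, hedge⟩ := WeightedDigraph.exists_isStochasticEmbedding (G := G) (K := 4 * z + 1)
    (by rw [hn]; linarith) (by linarith) hL hS0 hS hSN
  rw [hn] at hdist hedge
  rw [hm] at hedge
  have hk0 : (0 : ℝ) ≤ (2 * k + 2) ^ 2 := by positivity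
  have hxy : 3 / 4 ≤ x * y := by nlinarith
  have hlog0 : 0 ≤ Real.log (2 * n) := Real.log_nonneg (by
    have : (3 : ℝ) ≤ n := by exact_mod_cast hn3
    linarith)
  refine ⟨P, hP, ?_, ?_⟩
  · intro u v
    by_cases hr : G.Reachable u v
    · refine (hdist u v hr).trans (mul_le_mul_left ?_ _)
      set κ := 2 * (4 * z + 1) * Real.log (2 * n) with hκ
      have hκ0 : 0 ≤ κ := mul_nonneg (by linarith) hlog0
      have hκ1 : κ ≤ 2 * (14 * y) * (2 * x) :=
        mul_le_mul (by linarith) h3 hlog0 (by linarith)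
      clear_value κ
      have e : (4 : ℝ≥0∞) + 26 * ENNReal.ofReal κ = ENNReal.ofReal (4 + 26 * κ) := by
        rw [ENNReal.ofReal_add (by norm_num) (by positivity), ENNReal.ofReal_mul (by norm_num)]
        norm_num
      rw [e]
      exact ENNReal.ofReal_le_ofReal (by nlinarith)
    -- For unreachable pairs the right side is infinite because the factor is positive.
    · rw [not_not.1 (mt WeightedDigraph.dist_ne_top_iff.1 hr), ENNReal.mul_top]
      · exact le_top
      · rw [Ne, ENNReal.ofReal_eq_zero, not_le]
        exact mul_pos (by linarith) (by linarith)
  · have hn0 : (0 : ℝ) ≤ n := Nat.cast_nonneg n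
    have hm0 : (0 : ℝ) ≤ m := Nat.cast_nonneg m
    have hhop : (2 : ℝ) * (n * (Nat.log 2 n + 1)) ≤ 2000 * (n * x) := by
      have : (n : ℝ) * (Nat.log 2 n + 1) ≤ n * (2 * x) :=
        mul_le_mul_of_nonneg_left (by linarith) hn0
      nlinarith [mul_nonneg hn0 (by linarith : 0 ≤ x)]
    have hnx : 0 ≤ n * x := mul_nonneg hn0 (by linarith)
    have hmx : 0 ≤ m * x ^ 2 := mul_nonneg hm0 (sq_nonneg x)
    intro D hD
    obtain ⟨d1, d2⟩ := hedge D hD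
    have d1' : (D.1.numEdges : ℝ) ≤ 2 * (n * (Nat.log 2 n + 1)) +
        m * ((k * (Nat.log 2 n + 1) + 2) * (k * (Nat.log 2 n + 1) + 2)) := by exact_mod_cast d1
    have d2' : (D.2.numEdges : ℝ) ≤ 2 * (n * (Nat.log 2 n + 1)) := by exact_mod_cast d2
    have hSx : (k : ℝ) * (Nat.log 2 n + 1) + 2 ≤ (2 * k + 2) * x := by
      have : (k : ℝ) * (Nat.log 2 n + 1) ≤ k * (2 * x) :=
        mul_le_mul_of_nonneg_left (by linarith) (Nat.cast_nonneg k)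
      linarith
    have hlink : (m : ℝ) * ((k * (Nat.log 2 n + 1) + 2) * (k * (Nat.log 2 n + 1) + 2)) ≤
        (2 * k + 2) ^ 2 * (m * x ^ 2) := by
      have := mul_le_mul_of_nonneg_left
        (mul_self_le_mul_self (by positivity) hSx) hm0
      linarith
    have e1 := mul_nonneg hk0 hnx
    constructor <;> nlinarith
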